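/- Notation. For $n,d\ge 1$ identify $(\mathbb R^n)^{\otimes d}$ with $\mathbb R^{n^d}$ with its Euclidean inner product, and let $\mathrm{Sym}^d(\mathbb R^n)\subseteq(\mathbb R^n)^{\otimes d}$ be the subspace of symmetric tensors, of dimension $\binom{n+d-1}{d}$. For a matrix $U\in\mathbb R^{n\times m}$ with columns $u_1,\dots,u_m$, let $U^{\circledast d}$ be the $n^d\times\binom{m+d-1}{d}$ matrix whose columns, indexed by the tuples $1\le i_1\le i_2\le\dots\le i_d\le m$, are the symmetric tensors $$\frac1{d!}\sum_{\pi\in S_d}u_{i_{\pi(1)}}\otimes\cdots\otimes u_{i_{\pi(d)}}.$$ For $\rho>0$, independent $\rho$-perturbations $\tilde U_1,\dots,\tilde U_t$ of $U_1,\dots,U_t\in\mathbb R^{n\times m}$ are random matrices such that all the entries of all the differences $\tilde U_j-U_j$ are independent with law $\mathcal N(0,\rho^2)$. A linear map $\Phi:\mathrm{Sym}^d(\mathbb R^n)\to\mathbb R^D$ is called an orthogonal projection if it is the orthogonal projection of $\mathrm{Sym}^d(\mathbb R^n)$ onto a subspace, followed by an isometric embedding of that subspace into $\mathbb R^D$.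 The $k$-th largest singular value of a matrix $A$ is $\sigma_k(A)$. Corollary 5.3. There is an absolute constant $C$, and for every integer $d\ge 1$ there is a constant $c_d>0$ depending only on $d$, such that for all $1\ge\delta_1>\delta_2>0$ there is a constant $c=c(d,\delta_1,\delta_2)>0$ with the following property. Let $n,m,t\ge 1$ and $D\ge 0$ be integers, let $\Phi:\mathrm{Sym}^d(\mathbb R^n)\to\mathbb R^D$ be an orthogonal projection of rank at least $\delta_1\binom{n+d-1}{d}$, and suppose that $$t\binom{m+d-1}{d}\le\delta_2\binom{n+d-1}{d}\qquad\text{and}\qquad m\le c_d(\delta_1-\delta_2)\,n .$$ Let $\rho>0$, let $U_1,\dots,U_t\in\mathbb R^{n\times m}$ be arbitrary matrices, and let $\tilde U_1,\dots,\tilde U_t$ be independent $\rho$-perturbations of them. Then, with probability at least $1-\exp(-c\,n)$, the least singular value satisfies $$\sigma_{t\binom{m+d-1}{d}}\Big(\Phi\,\big[\,\tilde U_1^{\circledast d}\ \ \tilde U_2^{\circledast d}\ \cdots\ \tilde U_t^{\circledast d}\,\big]\Big)\ \ge\ \frac{\rho^d}{\sqrt t\;n^{Cd}} .$$ -/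

import Mathlib

open MeasureTheory ProbabilityTheory Module
open scoped BigOperators NNReal

/-- The space `Sym^d(ℝⁿ)` of symmetric tensors of order `d`, as a subspace of
`(ℝⁿ)^{⊗ d} ≅ ℝ^{n^d}` with the Euclidean inner product: a tensor `T` has one coordinate `T a` for
each `a : Fin d → Fin n`, and it is symmetric when permuting the `d` modes leaves it unchanged. -/
def SymTensor (n d : ℕ) : Submodule ℝ (EuclideanSpace ℝ (Fin d → Fin n)) where
  carrier := {T | ∀ (π : Equiv.Perm (Fin d)) (a : Fin d → Fin n), T (a ∘ π) = T a}
  add_mem' := by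
    intro S T hS hT π a
    simp [hS π a, hT π a]
  zero_mem' := by
    intro π a
    simp
  smul_mem' := by
    intro c T hT π a
    simp [hT π a]

/-- The tuples `i₁ ≤ i₂ ≤ ⋯ ≤ i_d` of elements of `Fin m`, which index the columns of `U^{⊛ d}`. -/
abbrev SortedTuple (d m : ℕ) : Type :=
  {I : Fin d → Fin m // ∀ k l : Fin d, k ≤ l → I k ≤ I l}

/-- The entries of the tensor `(1 / d!) ∑_π u_{i_{π(1)}} ⊗ ⋯ ⊗ u_{i_{π(d)}}`, where `u_i` is the
`i`-th column of `U` and `π` runs over the permutations of the `d` positions. -/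
noncomputable def symProdTensor {n m d : ℕ} (U : Matrix (Fin n) (Fin m) ℝ) (I : Fin d → Fin m) :
    EuclideanSpace ℝ (Fin d → Fin n) :=
  WithLp.toLp 2 fun a => (1 / (d.factorial : ℝ)) * ∑ π : Equiv.Perm (Fin d), ∏ k, U (a k) (I (π k))

theorem symProdTensor_mem {n m d : ℕ} (U : Matrix (Fin n) (Fin m) ℝ) (I : Fin d → Fin m) :
    symProdTensor U I ∈ SymTensor n d := by
  intro σ a
  simp only [symProdTensor, Function.comp_apply]
  congr 1
  refine Fintype.sum_equiv (Equiv.mulRight σ⁻¹) _ _ fun π => ?_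
  refine Fintype.prod_equiv σ _ _ fun k => ?_
  simp

/-- The column of `U^{⊛ d}` indexed by `I`, as an element of `Sym^d(ℝⁿ)`. -/
noncomputable def symKronCol {n m d : ℕ} (U : Matrix (Fin n) (Fin m) ℝ) (I : SortedTuple d m) :
    SymTensor n d :=
  ⟨symProdTensor U I.1, symProdTensor_mem U I.1⟩

/-- The block matrix `[U₁^{⊛ d} ⋯ U_t^{⊛ d}]`, as the linear map which sends a coefficient vector
to the corresponding linear combination of the columns. -/
noncomputable def blockSymKron {n m d t : ℕ} (U : Fin t → Matrix (Fin n) (Fin m) ℝ) :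
    EuclideanSpace ℝ (Fin t × SortedTuple d m) →ₗ[ℝ] SymTensor n d where
  toFun α := ∑ p, α p • symKronCol (U p.1) p.2
  map_add' α β := by simp [add_smul, Finset.sum_add_distrib]
  map_smul' c α := by simp [mul_smul, Finset.smul_sum]

/-- `Φ : Sym^d(ℝⁿ) → ℝ^D` is an orthogonal projection: the orthogonal projection onto some subspace
`S` of `Sym^d(ℝⁿ)`, with values written in `ℝ^D` through an isometric embedding of `S`.
(`ℝ^D` may be a coordinate copy of `Sym^d(ℝⁿ)` itself, or of `S`.) -/
def IsOrthogonalProjection {n d D : ℕ} (Φ : SymTensor n d →ₗ[ℝ] EuclideanSpace ℝ (Fin D)) : Prop :=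
  ∃ (S : Submodule ℝ (SymTensor n d)) (j : S →ₗᵢ[ℝ] EuclideanSpace ℝ (Fin D)),
    ∀ T, Φ T = j (S.orthogonalProjectionOnto T)

/-- The random matrices `Ut ω 1, …, Ut ω t` are independent `ρ`-perturbations of `U 1, …, U t`:
the entries of all the differences `Ut ω j - U j` are independent with law `N(0, ρ²)`. -/
def AreIndepPerturbations {Ω : Type*} [MeasurableSpace Ω] (μ : Measure Ω) {n m t : ℕ} (ρ : ℝ)
    (U : Fin t → Matrix (Fin n) (Fin m) ℝ) (Ut : Ω → Fin t → Matrix (Fin n) (Fin m) ℝ) : Prop :=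
  (∀ (j : Fin t) (a : Fin n) (b : Fin m),
    HasLaw (fun ω => Ut ω j a b - U j a b) (gaussianReal 0 ⟨ρ ^ 2, sq_nonneg ρ⟩) μ) ∧
  iIndepFun (fun (p : Fin t × Fin n × Fin m) (ω : Ω) =>
    Ut ω p.1 p.2.1 p.2.2 - U p.1 p.2.1 p.2.2) μ

/-- The `k`-th largest singular value `σ_k(A)`, for `k ≥ 1` (Mathlib counts from `0`). -/
noncomputable def sigma {E F : Type*} [NormedAddCommGroup E] [InnerProductSpace ℝ E]
    [FiniteDimensional ℝ E] [NormedAddCommGroup F] [InnerProductSpace ℝ F] [FiniteDimensional ℝ F]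
    (k : ℕ) (A : E →ₗ[ℝ] F) : ℝ :=
  A.singularValues (k - 1)

/-! It suffices to bound every coordinate of a coefficient vector `α` by a multiple of the norm of
its image. The `j`-th block of `α` is a homogeneous polynomial of degree `d` in `m` variables, and
polarization recovers each of its coefficients from `2 ^ d` values, at points of norm at most `d`
(`abs_coeff_le_of_abs_blockPoly_le`). After a union bound, what remains is a fixed block `j₀`, a
fixed point `a`, and the event that some `α` whose block has value 1 at `a` is almost annihilated.

Let `S` be the subspace onto which `Φ` projects. Block `j₀` splits as `h aᵀ + W` with `h` Gaussian
and independent of `W` and of the other blocks (`measure_gaussian_split_le`). Conditionally on the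
latter, let `R ⊆ S` consist of the tensors that are orthogonal to the columns of the other blocks
and whose contractions with the columns of `W` vanish. This costs at most `t * choose (m+d-1) d + m
* n^(d-1)` dimensions, so `R` is still large. On `R` the pairing with the image of `α` is its value
at `a` times `⟨T, h ⊗ ⋯ ⊗ h⟩` (`exists_submodule_inner_blockSymKron`). The bad event thus forces all
of `R` to be almost orthogonal to `h ⊗ ⋯ ⊗ h`, a condition free of `α`: no net is needed.

That this is exponentially unlikely is `measure_smallSet_le`, by induction on `d`. The derivative of
`⟨T, h ⊗ ⋯ ⊗ h⟩` in `h_j` is `d` times the same pairing for the `j`-th slice of `T`. Some slice is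
robustly injective on a subspace of proportional dimension. Either all these slices are almost
orthogonal to the lower power of `h`, which the induction covers, or a polynomial in `h_j` is small
where its derivative is large, which is unlikely in `h_j` alone. Tensors with zero `j`-th slice do
not involve `h_j`, so repeating the argument inside them multiplies the small probabilities, about
`n` times in all. -/

/-! ### Subspaces on which an operator is robustly injective -/

/-- A contraction `A` satisfies `‖A x‖² ≥ τ ‖x‖²` on a subspace whose dimension is at least
`tr (A* A) - τ * dim E`. -/
theorem exists_submodule_le_norm_sq {E F : Type*} [NormedAddCommGroup E] [InnerProductSpace ℝ E]
    [FiniteDimensional ℝ E] [NormedAddCommGroup F] [InnerProductSpace ℝ F] [FiniteDimensional ℝ F]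
    (A : E →ₗ[ℝ] F) (hA : ∀ x, ‖A x‖ ≤ ‖x‖) (τ : ℝ) (hτ : 0 ≤ τ) :
    ∃ S : Submodule ℝ E, LinearMap.trace ℝ E (LinearMap.adjoint A ∘ₗ A) ≤
        finrank ℝ S + τ * finrank ℝ E ∧ ∀ x ∈ S, τ * ‖x‖ ^ 2 ≤ ‖A x‖ ^ 2 := by
  classical
  have hB : (LinearMap.adjoint A ∘ₗ A).IsSymmetric :=
    (LinearMap.isPositive_adjoint_comp_self A).isSymmetric
  set B := LinearMap.adjoint A ∘ₗ A with hBdef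
  set v := hB.eigenvectorBasis rfl with hv
  set l := hB.eigenvalues rfl with hl
  have hBx : ∀ x, inner ℝ (B x) x = ‖A x‖ ^ 2 := by
    intro x
    rw [hBdef, LinearMap.comp_apply, LinearMap.adjoint_inner_left, real_inner_self_eq_norm_sq]
  have hlA : ∀ i, l i = ‖A (v i)‖ ^ 2 := by
    intro i
    rw [← hBx, hv, hB.apply_eigenvectorBasis rfl i]
    simp [inner_smul_left, hl]
  have hl1 : ∀ i, l i ≤ 1 := by
    intro i
    rw [hlA]
    have := hA (v i)
    rw [v.norm_eq_one] at this
    nlinarith [norm_nonneg (A (v i))]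
  -- All eigenvalues are at most 1, so the trace is at most the number of those above `τ`, plus `τ`
  -- for each of the others.
  let I : Finset (Fin (finrank ℝ E)) := Finset.univ.filter fun i => τ ≤ l i
  refine ⟨Submodule.span ℝ (Set.range fun i : I => v i), ?_, ?_⟩
  · have hli : LinearIndependent ℝ (fun i : I => v i) :=
      v.orthonormal.linearIndependent.comp _ Subtype.val_injective
    rw [finrank_span_eq_card hli, Fintype.card_coe]
    rw [hB.trace_eq_sum_eigenvalues rfl]
    have h1 : ∀ i, l i ≤ (if i ∈ I then 1 else 0) + τ := by
      intro i
      split_ifs with h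
      · linarith [hl1 i]
      · simp only [I, Finset.mem_filter, Finset.mem_univ, true_and, not_le] at h
        linarith
    calc _ ≤ ∑ i, ((if i ∈ I then (1 : ℝ) else 0) + τ) := Finset.sum_le_sum fun i _ => h1 i
      _ = _ := by
        rw [Finset.sum_add_distrib]
        simp [mul_comm]
  · intro x hx
    have hzero : ∀ i ∉ I, inner ℝ (v i) x = 0 := by
      intro i hi
      have : x ∈ (Submodule.span ℝ {v i})ᗮ := by
        refine (Submodule.span_le.2 ?_) hx
        rintro _ ⟨k, rfl⟩
        rw [SetLike.mem_coe, Submodule.mem_orthogonal_singleton_iff_inner_right]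
        apply v.orthonormal.2
        rintro rfl
        exact hi k.2
      rwa [Submodule.mem_orthogonal_singleton_iff_inner_right] at this
    have h2 : ‖A x‖ ^ 2 = ∑ i, l i * (inner ℝ (v i) x) ^ 2 := by
      rw [← hBx, ← v.sum_inner_mul_inner]
      refine Finset.sum_congr rfl fun i _ => ?_
      rw [hB x (v i), hv, hB.apply_eigenvectorBasis rfl i, inner_smul_right,
        real_inner_comm x]
      simp only [hl, RCLike.ofReal_real_eq_id, id]
      ring
    rw [h2, ← v.sum_sq_inner_right x, Finset.mul_sum]
    refine Finset.sum_le_sum fun i _ => ?_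
    by_cases h : i ∈ I
    · exact mul_le_mul_of_nonneg_right (by simpa [I] using h) (sq_nonneg _)
    · simp [hzero i h]

/-- If the operators `A j` form a partition of the identity, `∑ ‖A j x‖² = ‖x‖²`, then one of them
is robustly injective on a subspace of proportional dimension. -/
theorem exists_index_submodule_norm_sq_le {ι E F : Type*} [Fintype ι] [Nonempty ι]
    [NormedAddCommGroup E] [InnerProductSpace ℝ E]
    [FiniteDimensional ℝ E] [NormedAddCommGroup F] [InnerProductSpace ℝ F] [FiniteDimensional ℝ F]
    (A : ι → E →ₗ[ℝ] F) (hA : ∀ x, ∑ j, ‖A j x‖ ^ 2 = ‖x‖ ^ 2) :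
    ∃ j, ∃ S : Submodule ℝ E, finrank ℝ E ≤ 2 * Fintype.card ι * finrank ℝ S ∧
      ∀ x ∈ S, ‖x‖ ^ 2 ≤ 2 * Fintype.card ι * ‖A j x‖ ^ 2 := by
  have hc : (0 : ℝ) < Fintype.card ι := by exact_mod_cast Fintype.card_pos
  have hA1 : ∀ j x, ‖A j x‖ ≤ ‖x‖ := by
    intro j x
    rw [← abs_norm (A j x), ← abs_norm x]
    rw [← sq_le_sq, ← hA x]
    exact Finset.single_le_sum (f := fun j => ‖A j x‖ ^ 2) (fun _ _ => sq_nonneg _)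
      (Finset.mem_univ j)
  have htr : ∑ j, LinearMap.trace ℝ E (LinearMap.adjoint (A j) ∘ₗ A j) = finrank ℝ E := by
    have hsum : ∑ j, LinearMap.adjoint (A j) ∘ₗ A j = LinearMap.id := by
      have hs : (∑ j, LinearMap.adjoint (A j) ∘ₗ A j - LinearMap.id).IsSymmetric := by
        refine LinearMap.IsSymmetric.sub ?_ LinearMap.IsSymmetric.id
        intro x y
        simp only [LinearMap.sum_apply, sum_inner, inner_sum]
        exact Finset.sum_congr rfl fun j _ =>
          (LinearMap.isPositive_adjoint_comp_self (A j)).isSymmetric x y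
      rw [← sub_eq_zero, ← hs.inner_map_self_eq_zero]
      intro x
      simp only [LinearMap.sub_apply, LinearMap.sum_apply, LinearMap.comp_apply, inner_sub_left,
        sum_inner, LinearMap.adjoint_inner_left, real_inner_self_eq_norm_sq, hA, LinearMap.id_apply,
        sub_self]
    rw [← map_sum, hsum, LinearMap.trace_id]
  obtain ⟨j, -, hj⟩ := Finset.exists_le_of_sum_le (s := Finset.univ)
    (f := fun _ : ι => (finrank ℝ E : ℝ) / Fintype.card ι)
    (g := fun j => LinearMap.trace ℝ E (LinearMap.adjoint (A j) ∘ₗ A j))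
    Finset.univ_nonempty (by
      rw [htr]
      simp only [Finset.sum_const, Finset.card_univ, nsmul_eq_mul]
      rw [mul_div_cancel₀ _ hc.ne'])
  -- Some `A j` has at least the average trace `dim E / |ι|`; this `τ` gives up half of it.
  obtain ⟨S, hS, hS2⟩ := exists_submodule_le_norm_sq (A j) (hA1 j) (1 / (2 * Fintype.card ι))
    (by positivity)
  refine ⟨j, S, ?_, fun x hx => ?_⟩
  · have h1 := hj.trans hS
    have h2 : (finrank ℝ E : ℝ) ≤ 2 * Fintype.card ι * finrank ℝ S := by
      field_simp at h1
      linarith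
    exact_mod_cast h2
  · have := hS2 x hx
    rw [div_mul_eq_mul_div, one_mul, div_le_iff₀ (by positivity)] at this
    linarith

/-! ### Slices of symmetric tensors -/

/-- The contraction of a tensor with the `j`-th coordinate vector in the first mode. -/
def tensorSlice {n d : ℕ} (j : Fin n) :
    EuclideanSpace ℝ (Fin (d + 1) → Fin n) →ₗ[ℝ] EuclideanSpace ℝ (Fin d → Fin n) where
  toFun T := WithLp.toLp 2 fun a => T (Fin.cons j a)
  map_add' S T := by ext; simp
  map_smul' c T := by ext; simp

@[simp]
theorem tensorSlice_apply {n d : ℕ} (j : Fin n) (T : EuclideanSpace ℝ (Fin (d + 1) → Fin n))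
    (a : Fin d → Fin n) : tensorSlice j T a = T (Fin.cons j a) := rfl

theorem sum_norm_sq_tensorSlice {n d : ℕ} (T : EuclideanSpace ℝ (Fin (d + 1) → Fin n)) :
    ∑ j, ‖tensorSlice j T‖ ^ 2 = ‖T‖ ^ 2 := by
  simp only [EuclideanSpace.norm_sq_eq, tensorSlice_apply]
  rw [← Fintype.sum_prod_type']
  exact Fintype.sum_equiv (Fin.consEquiv fun _ => Fin n) _ _ fun p => rfl

theorem SymTensor.apply_comp {n d : ℕ} {T : EuclideanSpace ℝ (Fin d → Fin n)}
    (hT : T ∈ SymTensor n d) (π : Equiv.Perm (Fin d)) (a : Fin d → Fin n) : T (a ∘ π) = T a :=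
  hT π a

theorem SymTensor.apply_insertNth {n d : ℕ} {T : EuclideanSpace ℝ (Fin (d + 1) → Fin n)}
    (hT : T ∈ SymTensor n (d + 1)) (k : Fin (d + 1)) (j : Fin n) (a : Fin d → Fin n) :
    T (k.insertNth j a) = T (Fin.cons j a) := by
  have h : k.insertNth j a = (Fin.cons j a : Fin (d + 1) → Fin n) ∘ k.cycleRange := by
    ext1 l
    have := Fin.insertNth_apply_cycleRange_symm (α := Fin n) k j a (k.cycleRange l)
    rw [Function.comp_apply, ← this, Equiv.symm_apply_apply]
  rw [h, SymTensor.apply_comp hT]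

theorem tensorSlice_mem {n d : ℕ} {T : EuclideanSpace ℝ (Fin (d + 1) → Fin n)}
    (hT : T ∈ SymTensor n (d + 1)) (j : Fin n) : tensorSlice j T ∈ SymTensor n d := by
  intro π a
  have h : (Fin.cons j (a ∘ π) : Fin (d + 1) → Fin n) =
      (Fin.cons j a : Fin (d + 1) → Fin n) ∘ Equiv.Perm.decomposeFin.symm (0, π) := by
    ext1 l
    refine Fin.cases ?_ (fun l => ?_) l
    · simp
    · simp
  rw [tensorSlice_apply, tensorSlice_apply, h, SymTensor.apply_comp hT]

/-- A subspace of tensors has a mode-one slice which is robustly injective on a subspace of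
proportional dimension. -/
theorem exists_tensorSlice_submodule {n d : ℕ} [NeZero n]
    (S : Submodule ℝ (EuclideanSpace ℝ (Fin (d + 1) → Fin n))) :
    ∃ j : Fin n, ∃ S' ≤ S, finrank ℝ S ≤ 2 * n * finrank ℝ S' ∧
      ∀ T ∈ S', ‖T‖ ^ 2 ≤ 2 * n * ‖tensorSlice j T‖ ^ 2 := by
  have hsum : ∀ x : S, ∑ j : Fin n, ‖(tensorSlice j ∘ₗ S.subtype) x‖ ^ 2 = ‖x‖ ^ 2 := by
    intro x
    exact sum_norm_sq_tensorSlice x.1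
  obtain ⟨j, S', h1, h2⟩ := exists_index_submodule_norm_sq_le
    (fun j : Fin n => tensorSlice j ∘ₗ S.subtype) hsum
  refine ⟨j, S'.map S.subtype, Submodule.map_subtype_le _ _, ?_, ?_⟩
  · rw [Submodule.finrank_map_subtype_eq]
    rwa [Fintype.card_fin] at h1
  · rintro _ ⟨x, hx, rfl⟩
    have := h2 x hx
    rw [Fintype.card_fin] at this
    exact this

/-! ### Univariate polynomials: small values with large derivative -/

open Polynomial in
/-- The set where a polynomial is small while its derivative is large has small measure. -/
theorem volume_abs_eval_le_and_lt_abs_derivative (p : ℝ[X]) {ε ε' : ℝ} (hε' : 0 < ε') :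
    volume {x : ℝ | |p.eval x| ≤ ε ∧ ε' < |p.derivative.eval x|} ≤
      p.natDegree * ENNReal.ofReal (2 * ε / ε') := by
  classical
  set A : Set ℝ := {x : ℝ | |p.eval x| ≤ ε ∧ ε' < |p.derivative.eval x|} with hA
  by_cases hp : p.derivative = 0
  · have : A = ∅ := by
      ext x
      simp [hA, hp, hε'.le]
    simp [this]
  have hAm : MeasurableSet A :=
    (measurableSet_le (f := fun x => |p.eval x|) (by fun_prop) measurable_const).inter
      (measurableSet_lt (g := fun x => |p.derivative.eval x|) measurable_const (by fun_prop))
  -- The number of critical points below `x`. By Rolle, `p` is injective where this is constant, and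
  -- it takes at most `natDegree` values.
  let cnt : ℝ → ℕ := fun x => (p.derivative.roots.toFinset.filter (· < x)).card
  have hcnt : Monotone cnt := fun x y hxy => Finset.card_le_card fun z hz => by
    simp only [Finset.mem_filter] at hz ⊢
    exact ⟨hz.1, hz.2.trans_le hxy⟩
  have hcnt_lt : ∀ x, cnt x < p.natDegree := by
    intro x
    have hd : 0 < p.natDegree := by
      rw [Nat.pos_iff_ne_zero]
      intro h
      exact hp (Polynomial.derivative_of_natDegree_zero h)
    calc cnt x ≤ p.derivative.roots.toFinset.card := Finset.card_filter_le _ _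
      _ ≤ Multiset.card p.derivative.roots := Multiset.toFinset_card_le _
      _ ≤ p.derivative.natDegree := Polynomial.card_roots' _
      _ < p.natDegree := Polynomial.natDegree_derivative_lt hd.ne'
  have hcover : A ⊆ ⋃ k ∈ Finset.range p.natDegree, A ∩ cnt ⁻¹' {k} := by
    intro x hx
    simp only [Set.mem_iUnion, Finset.mem_range]
    exact ⟨cnt x, hcnt_lt x, hx, rfl⟩
  have hpiece : ∀ k, volume (A ∩ cnt ⁻¹' {k}) ≤ ENNReal.ofReal (2 * ε / ε') := by
    intro k
    set B := A ∩ cnt ⁻¹' {k}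
    have hBm : MeasurableSet B := hAm.inter (hcnt.measurable (MeasurableSet.singleton k))
    have hlt : ∀ x ∈ B, ∀ y ∈ B, x < y → p.eval x ≠ p.eval y := by
      intro x hx y hy hxy heq
      obtain ⟨c, hc, hc0⟩ := exists_deriv_eq_zero (f := fun x => p.eval x) hxy
        p.continuous.continuousOn heq
      rw [Polynomial.deriv] at hc0
      have h1 : cnt x < cnt y := by
        refine Finset.card_lt_card ⟨fun z hz => ?_, fun h => ?_⟩
        · simp only [Finset.mem_filter] at hz ⊢
          exact ⟨hz.1, hz.2.trans hxy⟩
        · have : c ∈ p.derivative.roots.toFinset.filter (· < y) := by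
            simp only [Finset.mem_filter, Multiset.mem_toFinset]
            exact ⟨(Polynomial.mem_roots hp).2 hc0, hc.2⟩
          exact absurd (Finset.mem_filter.1 (h this)).2 (not_lt.2 hc.1.le)
      have hx2 : cnt x = k := hx.2
      have hy2 : cnt y = k := hy.2
      omega
    have hinj : Set.InjOn (fun x => p.eval x) B := by
      intro x hx y hy hxy
      rcases lt_trichotomy x y with h | h | h
      · exact absurd hxy (hlt x hx y hy h)
      · exact h
      · exact absurd hxy.symm (hlt y hy x hx h)
    have himg : volume ((fun x => p.eval x) '' B) ≤ ENNReal.ofReal (2 * ε) := by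
      have : (fun x => p.eval x) '' B ⊆ Set.Icc (-ε) ε := by
        rintro _ ⟨x, hx, rfl⟩
        exact abs_le.1 hx.1.1
      refine (measure_mono this).trans ?_
      rw [Real.volume_Icc]
      exact ENNReal.ofReal_le_ofReal (by linarith)
    -- Change of variables: the image has length at most `2 * ε`, and the derivative exceeds `ε'`
    -- throughout.
    have harea := lintegral_image_eq_lintegral_abs_deriv_mul hBm
      (fun x _ => (p.hasDerivAt x).hasDerivWithinAt) hinj (fun _ => 1)
    simp only [lintegral_const, MeasurableSet.univ, Measure.restrict_apply, Set.univ_inter,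
      one_mul, mul_one] at harea
    have hlow : ENNReal.ofReal ε' * volume B ≤
        ∫⁻ x in B, ENNReal.ofReal |p.derivative.eval x| := by
      rw [← setLIntegral_const]
      exact setLIntegral_mono' hBm fun x hx => ENNReal.ofReal_le_ofReal hx.1.2.le
    rw [ENNReal.ofReal_div_of_pos hε', ENNReal.le_div_iff_mul_le
      (Or.inl (by simpa using hε')) (Or.inl ENNReal.ofReal_ne_top), mul_comm]
    exact hlow.trans (harea ▸ himg)
  calc volume A ≤ ∑ k ∈ Finset.range p.natDegree, volume (A ∩ cnt ⁻¹' {k}) :=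
        (measure_mono hcover).trans (measure_biUnion_finset_le _ _)
    _ ≤ ∑ k ∈ Finset.range p.natDegree, ENNReal.ofReal (2 * ε / ε') :=
        Finset.sum_le_sum fun k _ => hpiece k
    _ = _ := by simp

open Polynomial in
/-- A version of `volume_abs_eval_le_and_lt_abs_derivative` for polynomials of bounded degree with
vector coefficients; the bound does not depend on the dimension. -/
theorem volume_forall_abs_eval_le_and_exists_lt_abs_derivative {E : Type*} [NormedAddCommGroup E]
    [InnerProductSpace ℝ E] [FiniteDimensional ℝ E] (p : E →ₗ[ℝ] ℝ[X]) (D : ℕ)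
    (hD : ∀ T, (p T).natDegree ≤ D) {ε ε' : ℝ} (hε' : 0 < ε') :
    volume {x : ℝ | (∀ T, |(p T).eval x| ≤ ε * ‖T‖) ∧
        ∃ T, ε' * ‖T‖ < |(p T).derivative.eval x|} ≤
      (D + 1) * (D * ENNReal.ofReal (2 * ε / (ε' / (D + 1)))) := by
  -- The range of `p` lies in the polynomials of degree at most `D`, so only `D + 1` orthonormal
  -- directions matter, whatever the dimension of `E`. A large derivative must already occur, up to
  -- the factor `D + 1`, in one of them.
  set K := LinearMap.ker p
  set b := stdOrthonormalBasis ℝ Kᗮ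
  have hq : finrank ℝ Kᗮ ≤ D + 1 := by
    have h1 := LinearMap.finrank_range_add_finrank_ker p
    have h2 := K.finrank_add_finrank_orthogonal
    have h3 : finrank ℝ (LinearMap.range p) ≤ D + 1 := by
      have hle : LinearMap.range p ≤ Polynomial.degreeLT ℝ (D + 1) := by
        rintro _ ⟨T, rfl⟩
        rw [Polynomial.mem_degreeLT]
        refine Polynomial.degree_le_natDegree.trans_lt ?_
        exact_mod_cast Nat.lt_succ_of_le (hD T)
      have : FiniteDimensional ℝ (Polynomial.degreeLT ℝ (D + 1)) :=
        (Polynomial.degreeLTEquiv ℝ (D + 1)).symm.finiteDimensional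
      refine (Submodule.finrank_mono hle).trans ?_
      rw [(Polynomial.degreeLTEquiv ℝ (D + 1)).finrank_eq]
      simp
    change _ + finrank ℝ K = _ at h1
    omega
  have hexp : ∀ T, p T = ∑ i, inner ℝ (b i : E) T • p (b i) := by
    intro T
    have h1 : T - (Kᗮ.orthogonalProjectionOnto T : E) ∈ K := by
      have := Kᗮ.sub_starProjection_mem_orthogonal T
      rwa [K.orthogonal_orthogonal] at this
    have h2 : p T = p (Kᗮ.orthogonalProjectionOnto T) := by
      rw [← sub_eq_zero, ← map_sub]
      exact h1
    have h3 := b.sum_repr' (Kᗮ.orthogonalProjectionOnto T)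
    rw [h2]
    conv_lhs => rw [← h3]
    simp only [Submodule.coe_sum, Submodule.coe_smul, map_sum, map_smul]
    refine Finset.sum_congr rfl fun i _ => ?_
    congr 1
    rw [Submodule.coe_inner]
    have := Kᗮ.sub_starProjection_mem_orthogonal T
    have h4 := Submodule.inner_right_of_mem_orthogonal (b i).2 this
    rw [inner_sub_right, sub_eq_zero] at h4
    exact h4.symm
  have hnorm : ∀ i, ‖(b i : E)‖ = 1 := fun i => b.norm_eq_one i
  have hcover : {x : ℝ | (∀ T, |(p T).eval x| ≤ ε * ‖T‖) ∧
        ∃ T, ε' * ‖T‖ < |(p T).derivative.eval x|} ⊆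
      ⋃ i ∈ (Finset.univ : Finset (Fin (finrank ℝ Kᗮ))), {x : ℝ | |(p (b i)).eval x| ≤ ε ∧
        ε' / (D + 1) < |(p (b i)).derivative.eval x|} := by
    rintro x ⟨h1, T, hT⟩
    simp only [Set.mem_iUnion, Finset.mem_univ, exists_prop, true_and]
    by_contra! hcon
    have h2 : ∀ i, |(p (b i)).derivative.eval x| ≤ ε' / (D + 1) := by
      intro i
      refine not_lt.1 fun h => hcon i ⟨?_, h⟩
      simpa [hnorm i] using h1 (b i)
    refine absurd hT (not_lt.2 ?_)
    calc |(p T).derivative.eval x|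
        = |∑ i, inner ℝ (b i : E) T * (p (b i)).derivative.eval x| := by
          rw [hexp T]
          simp [Polynomial.eval_finsetSum]
      _ ≤ ∑ i, |inner ℝ (b i : E) T| * |(p (b i)).derivative.eval x| := by
          refine (Finset.abs_sum_le_sum_abs _ _).trans_eq ?_
          simp only [abs_mul]
      _ ≤ ∑ i : Fin (finrank ℝ Kᗮ), ‖T‖ * (ε' / (D + 1)) := by
          refine Finset.sum_le_sum fun i _ => mul_le_mul ?_ (h2 i) (abs_nonneg _) (norm_nonneg _)
          have := abs_real_inner_le_norm (b i : E) T
          rwa [hnorm i, one_mul] at this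
      _ = (finrank ℝ Kᗮ : ℝ) * (‖T‖ * (ε' / (D + 1))) := by simp
      _ ≤ (D + 1 : ℝ) * (‖T‖ * (ε' / (D + 1))) := by
          gcongr
          exact_mod_cast hq
      _ = ε' * ‖T‖ := by field_simp
  refine ((measure_mono hcover).trans (measure_biUnion_finset_le _ _)).trans ?_
  calc _ ≤ ∑ i : Fin (finrank ℝ Kᗮ), (D * ENNReal.ofReal (2 * ε / (ε' / (D + 1))) : ENNReal) := by
        refine Finset.sum_le_sum fun i _ =>
          (volume_abs_eval_le_and_lt_abs_derivative (p (b i)) (by positivity)).trans ?_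
        gcongr
        exact_mod_cast hD _
    _ = (finrank ℝ Kᗮ : ENNReal) * (D * ENNReal.ofReal (2 * ε / (ε' / (D + 1)))) := by simp
    _ ≤ _ := by
        gcongr
        exact_mod_cast hq

/-! ### Tensor powers along coordinate lines -/

/-- The pairing `⟨T, h ⊗ ⋯ ⊗ h⟩`. -/
def powEval {n d : ℕ} (T : EuclideanSpace ℝ (Fin d → Fin n)) (h : Fin n → ℝ) : ℝ :=
  ∑ a, T a * ∏ k, h (a k)

theorem continuous_powEval {n d : ℕ} (T : EuclideanSpace ℝ (Fin d → Fin n)) :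
    Continuous (powEval T) := by
  unfold powEval
  fun_prop

/-- The restriction of `powEval T` to a line parallel to the `j`-th axis, as a polynomial. -/
noncomputable def powPoly {n d : ℕ} (h : Fin n → ℝ) (j : Fin n) :
    EuclideanSpace ℝ (Fin d → Fin n) →ₗ[ℝ] Polynomial ℝ where
  toFun T := ∑ a, T a • ∏ k, (if a k = j then Polynomial.X else Polynomial.C (h (a k)))
  map_add' S T := by simp [add_smul, Finset.sum_add_distrib]
  map_smul' c T := by simp [mul_smul, Finset.smul_sum]

theorem powPoly_apply {n d : ℕ} (h : Fin n → ℝ) (j : Fin n)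
    (T : EuclideanSpace ℝ (Fin d → Fin n)) :
    powPoly h j T = ∑ a, T a • ∏ k, (if a k = j then Polynomial.X else Polynomial.C (h (a k))) :=
  rfl

theorem eval_powPoly {n d : ℕ} (h : Fin n → ℝ) (j : Fin n)
    (T : EuclideanSpace ℝ (Fin d → Fin n)) (x : ℝ) :
    (powPoly h j T).eval x = powEval T (Function.update h j x) := by
  rw [powPoly_apply, powEval, Polynomial.eval_finsetSum]
  refine Finset.sum_congr rfl fun a _ => ?_
  rw [Polynomial.eval_smul, Polynomial.eval_prod, smul_eq_mul]
  congr 1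
  refine Finset.prod_congr rfl fun k _ => ?_
  by_cases hk : a k = j <;> simp [hk]

theorem natDegree_powPoly_le {n d : ℕ} (h : Fin n → ℝ) (j : Fin n)
    (T : EuclideanSpace ℝ (Fin d → Fin n)) : (powPoly h j T).natDegree ≤ d := by
  rw [powPoly_apply]
  refine Polynomial.natDegree_sum_le_of_forall_le _ _ fun a _ => ?_
  refine (Polynomial.natDegree_smul_le _ _).trans ((Polynomial.natDegree_prod_le _ _).trans ?_)
  refine (Finset.sum_le_sum (g := fun _ => 1) fun k _ => ?_).trans (by simp)
  split_ifs
  · exact Polynomial.natDegree_X_le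
  · simp

theorem Fin.prod_erase_eq_prod_succAbove {M : Type*} [CommMonoid M] {d : ℕ} (k : Fin (d + 1))
    (f : Fin (d + 1) → M) : ∏ l ∈ Finset.univ.erase k, f l = ∏ l, f (k.succAbove l) := by
  rw [← Finset.compl_singleton, ← Fin.image_succAbove_univ, Finset.prod_image]
  exact fun x _ y _ hxy => Fin.succAbove_right_injective hxy

/-- The product rule gives one term for each position holding the index `j`; by symmetry the `d + 1`
terms agree. -/
theorem eval_derivative_powPoly {n d : ℕ} (h : Fin n → ℝ) (j : Fin n)
    {T : EuclideanSpace ℝ (Fin (d + 1) → Fin n)} (hT : T ∈ SymTensor n (d + 1)) (x : ℝ) :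
    (powPoly h j T).derivative.eval x =
      (d + 1) * powEval (tensorSlice j T) (Function.update h j x) := by
  set y := Function.update h j x
  have h1 : (powPoly h j T).derivative.eval x =
      ∑ k : Fin (d + 1), ∑ a : Fin (d + 1) → Fin n,
        T a * ((∏ l, y (a (k.succAbove l))) * if a k = j then 1 else 0) := by
    rw [powPoly_apply, Polynomial.derivative_sum, Polynomial.eval_finsetSum, Finset.sum_comm]
    refine Finset.sum_congr rfl fun a _ => ?_
    rw [Polynomial.derivative_smul, Polynomial.eval_smul, Polynomial.derivative_prod_finset,
      Polynomial.eval_finsetSum, smul_eq_mul, Finset.mul_sum]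
    refine Finset.sum_congr rfl fun k _ => ?_
    rw [Polynomial.eval_mul, Polynomial.eval_prod, Fin.prod_erase_eq_prod_succAbove]
    congr 2
    · refine Finset.prod_congr rfl fun l _ => ?_
      by_cases hl : a (k.succAbove l) = j <;> simp [hl, y]
    · split_ifs <;> simp
  have h2 : ∀ k : Fin (d + 1), ∑ a : Fin (d + 1) → Fin n,
        T a * ((∏ l, y (a (k.succAbove l))) * if a k = j then 1 else 0) =
      powEval (tensorSlice j T) y := by
    intro k
    rw [← (Fin.insertNthEquiv (fun _ => Fin n) k).sum_comp, Fintype.sum_prod_type]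
    simp only [Fin.insertNthEquiv_apply, Fin.insertNth_apply_succAbove, Fin.insertNth_apply_same]
    rw [Finset.sum_eq_single j]
    · refine Finset.sum_congr rfl fun b _ => ?_
      change T (k.insertNth j b) * _ = _
      rw [SymTensor.apply_insertNth hT]
      simp
    · intro i _ hij
      simp [hij]
    · simp
  rw [h1, Finset.sum_congr rfl fun k _ => h2 k]
  simp

/-! ### The small ball estimate for symmetric tensors -/

/-- The vectors `h` for which all tensors in `S` are almost orthogonal to `h ⊗ ⋯ ⊗ h`. -/
def smallSet {n d : ℕ} (S : Submodule ℝ (EuclideanSpace ℝ (Fin d → Fin n))) (ε : ℝ) :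
    Set (Fin n → ℝ) :=
  {h | ∀ T ∈ S, |powEval T h| ≤ ε * ‖T‖}

theorem isClosed_smallSet {n d : ℕ} (S : Submodule ℝ (EuclideanSpace ℝ (Fin d → Fin n)))
    (ε : ℝ) : IsClosed (smallSet S ε) := by
  have : smallSet S ε = ⋂ T ∈ S, {h | |powEval T h| ≤ ε * ‖T‖} := by
    ext
    simp [smallSet]
  rw [this]
  exact isClosed_biInter fun T _ =>
    isClosed_le (continuous_powEval T).abs continuous_const

theorem smallSet_anti {n d : ℕ} {S S' : Submodule ℝ (EuclideanSpace ℝ (Fin d → Fin n))}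
    (h : S' ≤ S) (ε : ℝ) : smallSet S ε ⊆ smallSet S' ε :=
  fun _ hx T hT => hx T (h hT)

/-- Failing to be small on the slices means that some derivative in `h_j` is large, up to the factor
`√(2 * n)` lost in slicing. The degree `d + 1` cancels against the factor from differentiation,
leaving `(d + 2) ^ 2`. -/
theorem volume_section_smallSet_le {n d : ℕ}
    {S : Submodule ℝ (EuclideanSpace ℝ (Fin (d + 1) → Fin n))} (hS : S ≤ SymTensor n (d + 1))
    (j : Fin n) (hj : ∀ T ∈ S, ‖T‖ ^ 2 ≤ 2 * n * ‖tensorSlice j T‖ ^ 2) (h : Fin n → ℝ)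
    {ε ε' : ℝ} (hε' : 0 < ε') :
    volume {x : ℝ | Function.update h j x ∈
        smallSet S ε \ smallSet (S.map (tensorSlice j)) ε'} ≤
      ENNReal.ofReal (2 * (d + 2) ^ 2 * √(2 * n) * (ε / ε')) := by
  have hn : (0 : ℝ) < n := by exact_mod_cast j.pos
  have hs : 0 < √(2 * n : ℝ) := Real.sqrt_pos.2 (by positivity)
  have key := volume_forall_abs_eval_le_and_exists_lt_abs_derivative
    ((powPoly h j).comp S.subtype) (d + 1) (fun T => natDegree_powPoly_le h j _)
    (ε := ε) (ε' := (d + 1) * (ε' / √(2 * n))) (by positivity)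
  refine (measure_mono ?_).trans (key.trans ?_)
  · rintro x ⟨h1, h2⟩
    refine ⟨fun T => ?_, ?_⟩
    · simp only [LinearMap.comp_apply, Submodule.subtype_apply, eval_powPoly]
      exact h1 T T.2
    · simp only [smallSet, Set.mem_ofPred_eq, Submodule.mem_map, not_forall, not_le] at h2
      obtain ⟨_, ⟨T, hT, rfl⟩, h3⟩ := h2
      refine ⟨⟨T, hT⟩, ?_⟩
      simp only [LinearMap.comp_apply, Submodule.subtype_apply]
      rw [eval_derivative_powPoly h j (hS hT), abs_mul, abs_of_pos (by positivity : (0 : ℝ) < d + 1),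
        mul_assoc]
      refine mul_lt_mul_of_pos_left (lt_of_le_of_lt ?_ h3) (by positivity)
      have h4 : ‖T‖ ≤ √(2 * n) * ‖tensorSlice j T‖ := by
        rw [← Real.sqrt_sq (norm_nonneg T), ← Real.sqrt_sq (norm_nonneg (tensorSlice j T)),
          ← Real.sqrt_mul (by positivity)]
        exact Real.sqrt_le_sqrt (hj T hT)
      calc ε' / √(2 * n) * ‖T‖ ≤ ε' / √(2 * n) * (√(2 * n) * ‖tensorSlice j T‖) := by
            gcongr
        _ = _ := by field_simp
  · have e1 : ((d + 1 : ℕ) : ENNReal) = ENNReal.ofReal (d + 1) := by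
      rw [← ENNReal.ofReal_natCast]; push_cast; rfl
    have e2 : ENNReal.ofReal (d + 1) + 1 = ENNReal.ofReal (d + 2) := by
      rw [← ENNReal.ofReal_one, ← ENNReal.ofReal_add (by positivity) (by positivity)]
      congr 1; ring
    rw [e1, e2, ← ENNReal.ofReal_mul (by positivity), ← ENNReal.ofReal_mul (by positivity)]
    refine ENNReal.ofReal_le_ofReal (le_of_eq ?_)
    push_cast
    field_simp
    ring

/-- Fubini in the single coordinate `j`, on which `B` does not depend. Iterating this turns
one-coordinate bounds into a product without any independence between the events. -/
theorem measure_pi_inter_le {n : ℕ} (ν : Measure ℝ) [IsProbabilityMeasure ν] (j : Fin n)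
    {A B : Set (Fin n → ℝ)} (hA : MeasurableSet A) (hB : MeasurableSet B)
    (hBj : ∀ h x, Function.update h j x ∈ B ↔ h ∈ B) (η : ENNReal)
    (hAj : ∀ h, ν {x | Function.update h j x ∈ A} ≤ η) :
    Measure.pi (fun _ : Fin n => ν) (A ∩ B) ≤ η * Measure.pi (fun _ : Fin n => ν) B := by
  have hAB := hA.inter hB
  rw [← lintegral_indicator_one hAB, ← lintegral_indicator_one hB, ← lintegral_const_mul _
    (measurable_one.indicator hB)]
  refine lintegral_le_of_lmarginal_le {j} (measurable_one.indicator hAB)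
    ((measurable_one.indicator hB).const_mul η) ?_
  intro h
  rw [lmarginal_singleton, lmarginal_singleton]
  have h1 : ∀ x, B.indicator (1 : (Fin n → ℝ) → ENNReal) (Function.update h j x) =
      B.indicator 1 h := by
    intro x
    by_cases hx : h ∈ B
    · rw [Set.indicator_of_mem hx, Set.indicator_of_mem ((hBj h x).2 hx)]; rfl
    · rw [Set.indicator_of_notMem hx, Set.indicator_of_notMem (fun H => hx ((hBj h x).1 H))]
  simp only [h1, lintegral_const, measure_univ, mul_one]
  by_cases hx : h ∈ B
  · rw [Set.indicator_of_mem hx, Pi.one_apply, mul_one]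
    refine le_trans (le_of_eq ?_) (hAj h)
    have hm : MeasurableSet {x | Function.update h j x ∈ A} :=
      (measurable_update h (a := j)) hA
    rw [← lintegral_indicator_one hm]
    refine lintegral_congr fun x => ?_
    by_cases hxA : Function.update h j x ∈ A
    · have h2 : Function.update h j x ∈ A ∩ B := ⟨hxA, (hBj h x).2 hx⟩
      rw [Set.indicator_of_mem h2]
      exact (Set.indicator_of_mem (s := {x | Function.update h j x ∈ A}) hxA 1).symm
    · have h2 : Function.update h j x ∉ A ∩ B := fun H => hxA H.1
      rw [Set.indicator_of_notMem h2]
      exact (Set.indicator_of_notMem (s := {x | Function.update h j x ∈ A}) hxA 1).symm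
  · rw [Set.indicator_of_notMem hx, mul_zero, nonpos_iff_eq_zero]
    rw [← lintegral_zero (μ := ν)]
    refine lintegral_congr fun x => Set.indicator_of_notMem (fun H => hx ((hBj h x).1 H.2)) _

/-- The tensor `T` does not involve the `i`-th coordinate. -/
def AvoidsCoord {n d : ℕ} (i : Fin n) (T : EuclideanSpace ℝ (Fin d → Fin n)) : Prop :=
  ∀ a, (∃ k, a k = i) → T a = 0

theorem AvoidsCoord.powEval_update {n d : ℕ} {i : Fin n} {T : EuclideanSpace ℝ (Fin d → Fin n)}
    (hT : AvoidsCoord i T) (h : Fin n → ℝ) (x : ℝ) :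
    powEval T (Function.update h i x) = powEval T h := by
  refine Finset.sum_congr rfl fun a _ => ?_
  by_cases ha : ∃ k, a k = i
  · rw [hT a ha, zero_mul, zero_mul]
  · push Not at ha
    congr 1
    exact Finset.prod_congr rfl fun k _ => Function.update_of_ne (ha k) _ _

theorem AvoidsCoord.tensorSlice {n d : ℕ} {i : Fin n}
    {T : EuclideanSpace ℝ (Fin (d + 1) → Fin n)} (hT : AvoidsCoord i T) (j : Fin n) :
    AvoidsCoord i (tensorSlice j T) := by
  rintro a ⟨k, hk⟩
  exact hT _ ⟨k.succ, by simpa using hk⟩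

/-- Symmetry moves an occurrence of `i` to the first mode, where the slice sees it. -/
theorem avoidsCoord_of_tensorSlice_eq_zero {n d : ℕ} {i : Fin n}
    {T : EuclideanSpace ℝ (Fin (d + 1) → Fin n)} (hT : T ∈ SymTensor n (d + 1))
    (h : tensorSlice i T = 0) : AvoidsCoord i T := by
  rintro a ⟨k, rfl⟩
  have h1 : a = k.insertNth (a k) (fun l => a (k.succAbove l)) :=
    (Fin.insertNth_self_removeNth k a).symm
  rw [h1, SymTensor.apply_insertNth hT]
  exact congrArg (fun T => T.ofLp (fun l => a (k.succAbove l))) h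

theorem update_mem_smallSet_iff {n d : ℕ} {i : Fin n}
    {S : Submodule ℝ (EuclideanSpace ℝ (Fin d → Fin n))} (hS : ∀ T ∈ S, AvoidsCoord i T)
    (ε : ℝ) (h : Fin n → ℝ) (x : ℝ) :
    Function.update h i x ∈ smallSet S ε ↔ h ∈ smallSet S ε :=
  forall₂_congr fun T hT => by rw [(hS T hT).powEval_update]

theorem finrank_le_finrank_inf_ker_add {E F : Type*} [AddCommGroup E] [Module ℝ E]
    [FiniteDimensional ℝ E] [AddCommGroup F] [Module ℝ F] [FiniteDimensional ℝ F]
    (S : Submodule ℝ E) (f : E →ₗ[ℝ] F) :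
    finrank ℝ S ≤ finrank ℝ (S ⊓ LinearMap.ker f : Submodule ℝ E) + finrank ℝ F := by
  have h1 := LinearMap.finrank_range_add_finrank_ker (f ∘ₗ S.subtype)
  have h2 : finrank ℝ (LinearMap.range (f ∘ₗ S.subtype)) ≤ finrank ℝ F := Submodule.finrank_le _
  have h3 : finrank ℝ (LinearMap.ker (f ∘ₗ S.subtype)) =
      finrank ℝ (S ⊓ LinearMap.ker f : Submodule ℝ _) := by
    rw [LinearMap.ker_comp, ← Submodule.finrank_map_subtype_eq, Submodule.map_comap_subtype]
  omega

theorem finrank_map_tensorSlice {n d : ℕ}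
    {S : Submodule ℝ (EuclideanSpace ℝ (Fin (d + 1) → Fin n))} {j : Fin n}
    (hj : ∀ T ∈ S, ‖T‖ ^ 2 ≤ 2 * n * ‖tensorSlice j T‖ ^ 2) :
    finrank ℝ (S.map (tensorSlice j)) = finrank ℝ S := by
  have hinj : Function.Injective (tensorSlice j ∘ₗ S.subtype) := by
    rw [← LinearMap.ker_eq_bot, LinearMap.ker_eq_bot']
    rintro ⟨T, hT⟩ h
    have h0 : tensorSlice j T = 0 := h
    have := hj T hT
    rw [h0, norm_zero] at this
    have h1 : ‖T‖ = 0 := by nlinarith [norm_nonneg T]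
    exact Subtype.ext (norm_eq_zero.1 h1)
  rw [← LinearMap.finrank_range_of_inj hinj, LinearMap.range_comp, Submodule.range_subtype]

/-- The inductive step of the small ball estimate: one exposes `r` coordinates one at a time. -/
theorem exists_cover_smallSet {n d : ℕ} [NeZero n] (ν : Measure ℝ) [IsProbabilityMeasure ν]
    {ε ε' : ℝ} (hε' : 0 < ε') {M : ℕ} {q η : ENNReal}
    (hν : ∀ A : Set ℝ, volume A ≤ ENNReal.ofReal (2 * (d + 2) ^ 2 * √(2 * n) * (ε / ε')) →
      ν A ≤ η)
    (hq : ∀ R ≤ SymTensor n d, M ≤ n * finrank ℝ R →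
      Measure.pi (fun _ : Fin n => ν) (smallSet R ε') ≤ q) (r : ℕ) :
    ∀ S ≤ SymTensor n (d + 1), 2 * M + r * n ^ d ≤ finrank ℝ S →
      ∃ N H : Set (Fin n → ℝ), MeasurableSet H ∧ smallSet S ε ⊆ N ∪ H ∧
        Measure.pi (fun _ : Fin n => ν) N ≤ r * q ∧ Measure.pi (fun _ : Fin n => ν) H ≤ η ^ r ∧
        ∀ i, (∀ T ∈ S, AvoidsCoord i T) → ∀ h x, Function.update h i x ∈ H ↔ h ∈ H := by
  induction r with
  | zero =>
    intro S _ _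
    exact ⟨∅, Set.univ, MeasurableSet.univ, by simp, by simp, by simp, by simp⟩
  | succ r ih =>
    intro S hS hdim
    obtain ⟨j, S', hS', hfin, hj⟩ := exists_tensorSlice_submodule S
    have hS'sym : S' ≤ SymTensor n (d + 1) := hS'.trans hS
    -- At a cost of at most `n ^ d` dimensions, the tensors no longer involve coordinate `j`, hence
    -- neither does the set `H` obtained from them.
    set S₁ := S ⊓ LinearMap.ker (tensorSlice j) with hS₁
    have hS₁av : ∀ T ∈ S₁, AvoidsCoord j T := fun T hT =>
      avoidsCoord_of_tensorSlice_eq_zero (hS hT.1) hT.2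
    have hdim₁ : 2 * M + r * n ^ d ≤ finrank ℝ S₁ := by
      have := finrank_le_finrank_inf_ker_add S (tensorSlice j)
      rw [← hS₁, finrank_euclideanSpace, Fintype.card_fun, Fintype.card_fin, Fintype.card_fin]
        at this
      rw [add_mul, one_mul] at hdim
      omega
    obtain ⟨N, H, hHm, hsub, hN, hH, hHinv⟩ := ih S₁ (inf_le_left.trans hS) hdim₁
    set R := S'.map (tensorSlice j) with hR
    set G := smallSet S' ε \ smallSet R ε' with hG
    have hGm : MeasurableSet G :=
      (isClosed_smallSet _ _).measurableSet.diff (isClosed_smallSet _ _).measurableSet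
    -- `N` collects the events handled by induction on the order. Outside them `h` lies in `G`,
    -- which is unlikely in coordinate `j`, and in `H`, which ignores that coordinate.
    refine ⟨N ∪ smallSet R ε', G ∩ H, hGm.inter hHm, ?_, ?_, ?_, ?_⟩
    · intro h hh
      by_cases h1 : h ∈ smallSet R ε'
      · exact Or.inl (Or.inr h1)
      · rcases hsub (smallSet_anti inf_le_left ε hh) with h2 | h2
        · exact Or.inl (Or.inl h2)
        · exact Or.inr ⟨⟨smallSet_anti hS' ε hh, h1⟩, h2⟩
    · refine (measure_union_le _ _).trans ?_
      have h1 : Measure.pi (fun _ : Fin n => ν) (smallSet R ε') ≤ q := by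
        refine hq R ?_ ?_
        · rintro _ ⟨T, hT, rfl⟩
          exact tensorSlice_mem (hS'sym hT) j
        · rw [hR, finrank_map_tensorSlice hj]
          have : 2 * M ≤ 2 * (n * finrank ℝ S') := by
            rw [← mul_assoc]
            exact (Nat.le_add_right _ _).trans (hdim.trans hfin)
          omega
      calc _ ≤ r * q + q := add_le_add hN h1
        _ = _ := by push_cast; ring
    · refine (measure_pi_inter_le ν j hGm hHm (hHinv j hS₁av) η fun h => hν _ ?_).trans ?_
      · exact volume_section_smallSet_le hS'sym j hj h hε'
      · rw [pow_succ']
        gcongr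
    · intro i hi h x
      have h1 := update_mem_smallSet_iff (fun T hT => hi T (hS' hT)) ε h x
      have h2 := update_mem_smallSet_iff (S := R) (i := i)
        (by rintro _ ⟨T, hT, rfl⟩; exact (hi T (hS' hT)).tensorSlice j) ε' h x
      have h3 := hHinv i (fun T hT => hi T hT.1) h x
      simp only [hG, Set.mem_inter_iff, Set.mem_sdiff, h1, h2, h3]

/-- Small ball estimate for symmetric tensors: if `h` has independent coordinates with density at
most `L`, and `S` is a large space of symmetric tensors, then it is exponentially unlikely that all
tensors in `S` are almost orthogonal to `h ⊗ ⋯ ⊗ h`. -/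
theorem measure_smallSet_le {n : ℕ} [NeZero n] (ν : Measure ℝ) [IsProbabilityMeasure ν]
    {L β γ : ℝ} (hL : 0 ≤ L) (hβ : 0 < β) (hν : ∀ A : Set ℝ, ν A ≤ ENNReal.ofReal L * volume A)
    {K : ℕ} (hK : 1 ≤ K) (d : ℕ) (hβγ : L * (2 * (d + 2) ^ 2 * √(2 * n) * β) ≤ γ)
    (S : Submodule ℝ (EuclideanSpace ℝ (Fin d → Fin n))) (hS : S ≤ SymTensor n d)
    (hdim : K * 4 ^ d * n ^ d ≤ n * finrank ℝ S) :
    Measure.pi (fun _ : Fin n => ν) (smallSet S (β ^ d / 2)) ≤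
      (K + 1) ^ d * ENNReal.ofReal γ ^ K := by
  induction d with
  | zero =>
    have hne : S ≠ ⊥ := by
      rintro rfl
      simp at hdim
      omega
    obtain ⟨T, hT, hT0⟩ := Submodule.exists_mem_ne_zero_of_ne_bot hne
    -- Tensors of order 0 are scalars with `|powEval T h| = ‖T‖`, so the level `1 / 2` is never
    -- reached.
    have hempty : smallSet S (β ^ 0 / 2) = ∅ := by
      ext h
      simp only [Set.mem_empty_iff_false, iff_false]
      intro hh
      have h1 := hh T hT
      have h2 : ‖T‖ = |powEval T h| := by
        rw [EuclideanSpace.norm_eq]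
        simp [powEval, Real.sqrt_sq_eq_abs]
      have h3 := norm_pos_iff.2 hT0
      rw [← h2] at h1
      norm_num at h1
      linarith
    rw [hempty]
    simp
  | succ d ih =>
    have hn : 0 < n := Nat.pos_of_ne_zero (NeZero.ne n)
    have hmono : L * (2 * (d + 2) ^ 2 * √(2 * n) * β) ≤ γ := by
      refine le_trans ?_ hβγ
      push_cast
      gcongr
      linarith
    -- The factor 4 gained with each order pays for the halving in the slice (`2 * M`) and for the
    -- `K` exposed coordinates (`K * n ^ d`).
    have hdim' : 2 * (K * 4 ^ d * n ^ d) + K * n ^ d ≤ finrank ℝ S := by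
      have h1 : n * (K * 4 ^ (d + 1) * n ^ d) ≤ n * finrank ℝ S := by
        refine le_trans (le_of_eq ?_) hdim
        ring
      have h2 := Nat.le_of_mul_le_mul_left h1 hn
      refine le_trans ?_ h2
      have h3 : 1 ≤ 4 ^ d := Nat.one_le_pow _ _ (by norm_num)
      have h4 : K * n ^ d * 1 ≤ K * n ^ d * 4 ^ d := Nat.mul_le_mul_left _ h3
      calc _ = 2 * (K * n ^ d * 4 ^ d) + K * n ^ d * 1 := by ring
        _ ≤ 2 * (K * n ^ d * 4 ^ d) + K * n ^ d * 4 ^ d := by omega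
        _ ≤ 4 * (K * n ^ d * 4 ^ d) := by omega
        _ = _ := by ring
    -- The levels are chosen with `ε / ε' = β`, so every exposure has probability at most `γ`.
    obtain ⟨N, H, -, hsub, hN, hH, -⟩ := exists_cover_smallSet (n := n) (d := d) ν
      (ε := β ^ (d + 1) / 2) (ε' := β ^ d / 2) (by positivity) (M := K * 4 ^ d * n ^ d)
      (q := (K + 1) ^ d * ENNReal.ofReal γ ^ K) (η := ENNReal.ofReal γ) (fun A hA => by
        refine (hν A).trans ?_
        refine (mul_le_mul_right hA _).trans ?_
        rw [← ENNReal.ofReal_mul hL]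
        refine ENNReal.ofReal_le_ofReal (le_trans (le_of_eq ?_) hmono)
        field_simp
        ring)
      (fun R hR hRd => ih hmono R hR hRd) K S hS hdim'
    refine (measure_mono hsub).trans ((measure_union_le _ _).trans ((add_le_add hN hH).trans ?_))
    have h1 : (1 : ENNReal) ≤ (K + 1) ^ d := one_le_pow₀ le_add_self
    calc (K : ENNReal) * ((K + 1) ^ d * ENNReal.ofReal γ ^ K) + ENNReal.ofReal γ ^ K
        ≤ K * ((K + 1) ^ d * ENNReal.ofReal γ ^ K) + (K + 1) ^ d * ENNReal.ofReal γ ^ K := by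
          gcongr
          exact le_mul_of_one_le_left zero_le h1
      _ = _ := by ring

/-! ### Gaussian density and splitting -/

theorem gaussianReal_le_volume (μ : ℝ) {v : ℝ≥0} (hv : v ≠ 0) {L : ℝ} (hL : 1 / √v ≤ L)
    (A : Set ℝ) : gaussianReal μ v A ≤ ENNReal.ofReal L * volume A := by
  have hv0 : (0 : ℝ) < v := by positivity
  rw [gaussianReal_apply _ hv, ← setLIntegral_const]
  refine lintegral_mono fun x => ENNReal.ofReal_le_ofReal ?_
  refine le_trans ?_ hL
  rw [gaussianPDFReal_def, one_div]
  refine (mul_le_of_le_one_right (by positivity) ?_).trans ?_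
  · rw [Real.exp_le_one_iff]
    exact div_nonpos_of_nonpos_of_nonneg (by nlinarith [sq_nonneg (x - μ)]) (by positivity)
  · refine inv_anti₀ (Real.sqrt_pos.2 hv0) (Real.sqrt_le_sqrt ?_)
    nlinarith [Real.pi_gt_three]

theorem covariance_sum_mul_sum_mul {Ω P : Type*} [MeasurableSpace Ω] [Fintype P]
    {μ : Measure Ω} [IsProbabilityMeasure μ] {X : P → Ω → ℝ} {v : ℝ≥0}
    (hX : ∀ p, HasLaw (X p) (gaussianReal 0 v) μ) (hind : iIndepFun X μ) (α β : P → ℝ) :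
    cov[fun ω => ∑ p, α p * X p ω, fun ω => ∑ p, β p * X p ω; μ] = v * ∑ p, α p * β p := by
  classical
  have hmem : ∀ p, MemLp (X p) 2 μ := fun p => (hX p).hasGaussianLaw.memLp_two
  rw [covariance_fun_sum_fun_sum (fun p => (hmem p).const_mul _) (fun p => (hmem p).const_mul _),
    Finset.mul_sum]
  refine Finset.sum_congr rfl fun p _ => ?_
  rw [Finset.sum_eq_single p]
  · rw [covariance_const_mul_left, covariance_const_mul_right, covariance_self
      (hmem p).aestronglyMeasurable.aemeasurable, (hX p).variance_eq, variance_id_gaussianReal]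
    ring
  · intro q _ hqp
    rw [covariance_const_mul_left, covariance_const_mul_right,
      (hind.indepFun hqp.symm).covariance_eq_zero (hmem p) (hmem q)]
    simp
  · simp

/-- Given orthogonal vectors `c b` of square norm `s`, a Gaussian vector splits into its component
along their span and an independent remainder. -/
theorem measure_gaussian_split_le {Ω P : Type*} [MeasurableSpace Ω] [Fintype P] {n : ℕ}
    {μ : Measure Ω} [IsProbabilityMeasure μ] {X : P → Ω → ℝ} {v v' : ℝ≥0}
    (hX : ∀ p, HasLaw (X p) (gaussianReal 0 v) μ) (hind : iIndepFun X μ) (c : Fin n → P → ℝ)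
    {s : ℝ} (hs : 0 < s) (hc : ∀ b b', ∑ p, c b p * c b' p = if b = b' then s else 0)
    (hv' : (v' : ℝ) = v / s) {E : Set ((Fin n → ℝ) × (P → ℝ))} (hE : MeasurableSet E)
    {q : ENNReal}
    (hq : ∀ w, Measure.pi (fun _ : Fin n => gaussianReal 0 v') {h | (h, w) ∈ E} ≤ q) :
    μ {ω | (fun b => ∑ p, s⁻¹ * c b p * X p ω,
      fun p => X p ω - ∑ b, c b p * ∑ p', s⁻¹ * c b p' * X p' ω) ∈ E} ≤ q := by
  classical
  set h : Fin n → Ω → ℝ := fun b ω => ∑ p, s⁻¹ * c b p * X p ω with hh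
  set w : P → Ω → ℝ := fun p ω => X p ω - ∑ b, c b p * h b ω with hw
  have hw' : ∀ q, w q = fun ω => ∑ p, ((if p = q then 1 else 0) -
      ∑ b, c b q * (s⁻¹ * c b p)) * X p ω := by
    intro q
    ext ω
    simp only [hw, hh, sub_mul, Finset.sum_sub_distrib, ite_mul, one_mul, zero_mul,
      Finset.sum_ite_eq', Finset.mem_univ, if_true]
    congr 1
    simp only [Finset.mul_sum, Finset.sum_mul]
    rw [Finset.sum_comm]
    refine Finset.sum_congr rfl fun p _ => Finset.sum_congr rfl fun b _ => by ring
  have hjoint : HasGaussianLaw (fun ω => (X · ω)) μ :=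
    hind.hasGaussianLaw fun p => (hX p).hasGaussianLaw
  -- Both components are linear images of one Gaussian vector, so zero covariance will give
  -- independence.
  have hhw : HasGaussianLaw (fun ω => (fun b => h b ω, fun p => w p ω)) μ := by
    let lh : (P → ℝ) →ₗ[ℝ] (Fin n → ℝ) :=
      LinearMap.pi fun b => ∑ p, (s⁻¹ * c b p) • LinearMap.proj p
    let lw : (P → ℝ) →ₗ[ℝ] (P → ℝ) :=
      LinearMap.pi fun q => LinearMap.proj q - ∑ b, c b q • (LinearMap.proj b ∘ₗ lh)
    have := hjoint.map_fun (LinearMap.toContinuousLinearMap (lh.prod lw))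
    have heq : (fun ω => (fun b => h b ω, fun p => w p ω)) =
        fun ω => LinearMap.toContinuousLinearMap (lh.prod lw) (X · ω) := by
      ext ω p
      · simp [lh, hh]
      · simp [lh, lw, hh, hw]
    rwa [heq]
  have hcovhw : ∀ b p, cov[h b, w p; μ] = 0 := by
    intro b q
    rw [hw' q, hh, covariance_sum_mul_sum_mul hX hind]
    have : ∑ p, s⁻¹ * c b p * ((if p = q then 1 else 0) - ∑ b', c b' q * (s⁻¹ * c b' p)) = 0 := by
      simp only [mul_sub, Finset.sum_sub_distrib, mul_ite, mul_one, mul_zero, Finset.sum_ite_eq',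
        Finset.mem_univ, if_true, Finset.mul_sum]
      rw [Finset.sum_comm]
      have h1 : ∀ b', ∑ p, s⁻¹ * c b p * (c b' q * (s⁻¹ * c b' p)) =
          s⁻¹ * s⁻¹ * c b' q * (if b = b' then s else 0) := by
        intro b'
        rw [← hc, Finset.mul_sum]
        exact Finset.sum_congr rfl fun p _ => by ring
      simp only [h1, mul_ite, mul_zero, Finset.sum_ite_eq, Finset.mem_univ, if_true]
      field_simp
      ring
    rw [this, mul_zero]
  have hindhw : IndepFun (fun ω b => h b ω) (fun ω p => w p ω) μ :=
    hhw.indepFun_of_covariance_eval hcovhw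
  have hcovh : ∀ b b', cov[h b, h b'; μ] = if b = b' then (v' : ℝ) else 0 := by
    intro b b'
    rw [hh, covariance_sum_mul_sum_mul hX hind]
    have : ∑ p, s⁻¹ * c b p * (s⁻¹ * c b' p) = s⁻¹ * s⁻¹ * (if b = b' then s else 0) := by
      rw [← hc, Finset.mul_sum]
      exact Finset.sum_congr rfl fun p _ => by ring
    rw [this, hv']
    split_ifs
    · field_simp
    · simp
  have hh_law : μ.map (fun ω b => h b ω) = Measure.pi fun _ : Fin n => gaussianReal 0 v' := by
    have hhg : HasGaussianLaw (fun ω => (h · ω)) μ := hhw.fst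
    have hi : iIndepFun h μ := hhg.iIndepFun_of_covariance_eq_zero
      fun b b' hb => by rw [hcovh, if_neg hb]
    rw [(iIndepFun_iff_map_fun_eq_pi_map fun b => (hhg.eval b).aemeasurable).1 hi]
    congr 1
    ext1 b
    rw [(hhg.eval b).map_eq_gaussianReal]
    congr 1
    · simp only [hh]
      rw [integral_finsetSum _ fun p _ => (hX p).hasGaussianLaw.integrable.const_mul _]
      refine Finset.sum_eq_zero fun p _ => ?_
      rw [integral_const_mul, (hX p).integral_eq, integral_id_gaussianReal, mul_zero]
    · rw [← covariance_self (hhg.eval b).aemeasurable]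
      have := hcovh b b
      rw [if_pos rfl] at this
      change (cov[h b, h b; μ]).toNNReal = v'
      rw [this, Real.toNNReal_coe]
  have hprod := (indepFun_iff_map_prod_eq_prod_map_map hhw.fst.aemeasurable
    hhw.snd.aemeasurable).1 hindhw
  change μ ((fun ω => (fun b => h b ω, fun p => w p ω)) ⁻¹' E) ≤ q
  have : IsProbabilityMeasure (μ.map fun ω p => w p ω) :=
    Measure.isProbabilityMeasure_map hhw.snd.aemeasurable
  rw [← Measure.map_apply_of_aemeasurable hhw.aemeasurable hE, hprod, hh_law,
    Measure.prod_apply_symm hE]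
  refine (lintegral_mono fun y => hq y).trans ?_
  simp

/-! ### Pairing tensors with the block matrix -/

/-- The multilinear form `(y₁, …, y_d) ↦ ⟨T, y₁ ⊗ ⋯ ⊗ y_d⟩`. -/
noncomputable def tensorForm {n d : ℕ} (T : EuclideanSpace ℝ (Fin d → Fin n)) :
    MultilinearMap ℝ (fun _ : Fin d => Fin n → ℝ) ℝ :=
  ∑ a : Fin d → Fin n, T a • (MultilinearMap.mkPiAlgebra ℝ (Fin d) ℝ).compLinearMap
    fun k => LinearMap.proj (a k)

theorem tensorForm_apply {n d : ℕ} (T : EuclideanSpace ℝ (Fin d → Fin n))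
    (y : Fin d → Fin n → ℝ) : tensorForm T y = ∑ a, T a * ∏ k, y k (a k) := by
  simp [tensorForm]

/-- Every permutation contributes the same pairing with a symmetric tensor, so the average over them
disappears. -/
theorem inner_symProdTensor {n m d : ℕ} {T : EuclideanSpace ℝ (Fin d → Fin n)}
    (hT : T ∈ SymTensor n d) (U : Matrix (Fin n) (Fin m) ℝ) (I : Fin d → Fin m) :
    inner ℝ T (symProdTensor U I) = tensorForm T (fun k b => U b (I k)) := by
  have h1 : ∀ π : Equiv.Perm (Fin d), ∑ a, T a * ∏ k, U (a k) (I (π k)) =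
      tensorForm T (fun k b => U b (I k)) := by
    intro π
    rw [tensorForm_apply, ← (Equiv.arrowCongr π⁻¹ (Equiv.refl (Fin n))).sum_comp]
    refine Finset.sum_congr rfl fun a _ => ?_
    have h2 : (Equiv.arrowCongr π⁻¹ (Equiv.refl (Fin n))) a = a ∘ π := by
      rfl
    rw [h2, SymTensor.apply_comp hT]
    congr 1
    exact Equiv.prod_comp π fun k => U (a k) (I k)
  have h3 : inner ℝ T (symProdTensor U I) =
      (1 / (d.factorial : ℝ)) * ∑ π : Equiv.Perm (Fin d), ∑ a, T a * ∏ k, U (a k) (I (π k)) := by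
    rw [PiLp.inner_apply, Finset.sum_comm, Finset.mul_sum]
    refine Finset.sum_congr rfl fun a _ => ?_
    simp only [symProdTensor, RCLike.inner_apply, conj_trivial]
    rw [← Finset.mul_sum]
    ring
  rw [h3, Finset.sum_congr rfl fun π _ => h1 π]
  have : (d.factorial : ℝ) ≠ 0 := by positivity
  simp [Fintype.card_perm, this]

/-- The contraction of a tensor with a vector in the first mode. -/
noncomputable def tensorContract {n d : ℕ} (w : Fin n → ℝ) :
    EuclideanSpace ℝ (Fin (d + 1) → Fin n) →ₗ[ℝ] EuclideanSpace ℝ (Fin d → Fin n) :=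
  ∑ j, w j • tensorSlice j

theorem tensorForm_eq_zero_of_tensorContract_eq_zero {n d : ℕ}
    {T : EuclideanSpace ℝ (Fin (d + 1) → Fin n)} (hT : T ∈ SymTensor n (d + 1)) {w : Fin n → ℝ}
    (hw : tensorContract w T = 0) {y : Fin (d + 1) → Fin n → ℝ} {k : Fin (d + 1)}
    (hk : y k = w) : tensorForm T y = 0 := by
  rw [tensorForm_apply, ← (Fin.insertNthEquiv (fun _ => Fin n) k).sum_comp, Fintype.sum_prod_type,
    Finset.sum_comm]
  refine Finset.sum_eq_zero fun b _ => ?_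
  have h1 : ∑ j, w j * T (Fin.cons j b) = 0 := by
    have := congrArg (fun S : EuclideanSpace ℝ (Fin d → Fin n) => S b) hw
    simpa [tensorContract] using this
  have h2 : ∀ j, T (Fin.insertNthEquiv (fun _ => Fin n) k (j, b)) *
      ∏ l, y l (Fin.insertNthEquiv (fun _ => Fin n) k (j, b) l) =
      (w j * T (Fin.cons j b)) * ∏ l, y (k.succAbove l) (b l) := by
    intro j
    change T (k.insertNth j b) * ∏ l, y l (k.insertNth (α := fun _ => Fin n) j b l) = _
    rw [SymTensor.apply_insertNth hT, Fin.prod_univ_succAbove _ k]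
    simp only [Fin.insertNth_apply_succAbove, Fin.insertNth_apply_same, hk]
    ring
  rw [Finset.sum_congr rfl fun j _ => h2 j, ← Finset.sum_mul, h1, zero_mul]

/-- In the multilinear expansion every term containing some `w k` contracts `T` to zero; only the
pure `h` term survives. -/
theorem tensorForm_smul_add {n d : ℕ}
    {T : EuclideanSpace ℝ (Fin (d + 1) → Fin n)} (hT : T ∈ SymTensor n (d + 1))
    (h : Fin n → ℝ) (a : Fin (d + 1) → ℝ) {w : Fin (d + 1) → Fin n → ℝ}
    (hw : ∀ k, tensorContract (w k) T = 0) :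
    tensorForm T (fun k => a k • h + w k) = (∏ k, a k) * powEval T h := by
  classical
  have h1 := (tensorForm T).map_add_univ (fun k => a k • h) w
  rw [Finset.sum_eq_single Finset.univ] at h1
  · rw [Finset.piecewise_univ, MultilinearMap.map_smul_univ, smul_eq_mul] at h1
    rw [powEval, ← tensorForm_apply]
    exact h1
  · intro s _ hs
    obtain ⟨k, hk⟩ : ∃ k, k ∉ s := by
      by_contra! hcon
      exact hs (Finset.eq_univ_iff_forall.2 hcon)
    exact tensorForm_eq_zero_of_tensorContract_eq_zero hT (hw k) (k := k)
      (Finset.piecewise_eq_of_notMem _ _ _ hk)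
  · simp

/-- The `j`-th block of the coefficient vector `α`, as a polynomial function evaluated at `a`. -/
def blockPoly {m d t : ℕ} (α : EuclideanSpace ℝ (Fin t × SortedTuple d m)) (j : Fin t)
    (a : Fin m → ℝ) : ℝ :=
  ∑ I : SortedTuple d m, α (j, I) * ∏ k, a (I.1 k)

theorem inner_symKronCol {n m d : ℕ} (T : SymTensor n d) (U : Matrix (Fin n) (Fin m) ℝ)
    (I : SortedTuple d m) :
    inner ℝ T (symKronCol U I) = tensorForm T.1 (fun k b => U b (I.1 k)) := by
  rw [Submodule.coe_inner]
  exact inner_symProdTensor T.2 U I.1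

/-- On the tensors in `S` which are orthogonal to the columns of all the blocks other than `j₀`, and
whose contractions with the columns of `W` vanish, the block matrix only depends on the component
of the block `j₀` along `h`. -/
theorem exists_submodule_inner_blockSymKron {n m d t : ℕ} (S : Submodule ℝ (SymTensor n (d + 1)))
    (U : Fin t → Matrix (Fin n) (Fin m) ℝ) (j₀ : Fin t) (W : Matrix (Fin n) (Fin m) ℝ) :
    ∃ R : Submodule ℝ (SymTensor n (d + 1)), R ≤ S ∧
      finrank ℝ S ≤ finrank ℝ R + (t * Fintype.card (SortedTuple (d + 1) m) + m * n ^ d) ∧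
      ∀ (h : Fin n → ℝ) (a : Fin m → ℝ) (V : Fin t → Matrix (Fin n) (Fin m) ℝ),
        (∀ j, j ≠ j₀ → V j = U j) → (∀ b i, V j₀ b i = a i * h b + W b i) →
        ∀ (α : EuclideanSpace ℝ (Fin t × SortedTuple (d + 1) m)), ∀ T ∈ R,
          inner ℝ T (blockSymKron V α) = blockPoly α j₀ a * powEval T.1 h := by
  classical
  -- Block `j₀` contributes zero conditions, so all `t` blocks can be counted uniformly.
  let f₁ : SymTensor n (d + 1) →ₗ[ℝ] (Fin t × SortedTuple (d + 1) m → ℝ) :=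
    LinearMap.pi fun p => if p.1 = j₀ then 0 else innerₗ _ (symKronCol (U p.1) p.2)
  let f₂ : SymTensor n (d + 1) →ₗ[ℝ] (Fin m → EuclideanSpace ℝ (Fin d → Fin n)) :=
    LinearMap.pi fun i => tensorContract (fun b => W b i) ∘ₗ (SymTensor n (d + 1)).subtype
  refine ⟨S ⊓ LinearMap.ker (f₁.prod f₂), inf_le_left, ?_, ?_⟩
  · refine (finrank_le_finrank_inf_ker_add S (f₁.prod f₂)).trans (le_of_eq ?_)
    congr 1
    simp [Module.finrank_prod, Module.finrank_pi_fintype]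
  · rintro h a V hV hV₀ α T ⟨-, hT⟩
    have hT' : f₁ T = 0 ∧ f₂ T = 0 := by
      simpa [LinearMap.mem_ker, Prod.ext_iff] using hT
    have hcol : ∀ j, j ≠ j₀ → ∀ I, inner ℝ T (symKronCol (V j) I) = 0 := by
      intro j hj I
      have := congrFun hT'.1 (j, I)
      simp only [f₁, LinearMap.pi_apply, hj, if_false] at this
      rw [hV j hj, real_inner_comm]
      exact this
    have hcon : ∀ i, tensorContract (fun b => W b i) T.1 = 0 := fun i => congrFun hT'.2 i
    have hcol₀ : ∀ I : SortedTuple (d + 1) m, inner ℝ T (symKronCol (V j₀) I) =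
        (∏ k, a (I.1 k)) * powEval T.1 h := by
      intro I
      rw [inner_symKronCol, ← tensorForm_smul_add T.2 h (fun k => a (I.1 k))
        (w := fun k b => W b (I.1 k)) fun k => hcon _]
      congr 1
      ext k b
      simp [hV₀]
    change inner ℝ T (∑ p, α p • symKronCol (V p.1) p.2) = _
    rw [inner_sum, Fintype.sum_prod_type, Finset.sum_eq_single j₀, blockPoly, Finset.sum_mul]
    · refine Finset.sum_congr rfl fun I _ => ?_
      refine (real_inner_smul_right T (symKronCol (V j₀) I) (α (j₀, I))).trans ?_
      rw [hcol₀]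
      ring
    · intro j _ hj
      refine Finset.sum_eq_zero fun I _ => ?_
      refine (real_inner_smul_right T (symKronCol (V j) I) (α (j, I))).trans ?_
      rw [hcol j hj, mul_zero]
    · simp

/-! ### Polarization -/

/-- Inclusion–exclusion over the values that `φ` misses. Surjective self-maps of `Fin d` are
permutations, so the right side is a permanent. -/
theorem sum_neg_one_pow_mul_prod_sum {d : ℕ} (b : Fin d → Fin d → ℝ) :
    ∑ u : Finset (Fin d), (-1) ^ u.card * ∏ k, ∑ l ∈ uᶜ, b k l =
      ∑ φ : Fin d → Fin d, if Function.Surjective φ then ∏ k, b k (φ k) else 0 := by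
  classical
  have h1 : ∀ u : Finset (Fin d), ∏ k, ∑ l ∈ uᶜ, b k l =
      ∑ φ : Fin d → Fin d, if u ⊆ (Finset.univ.image φ)ᶜ then ∏ k, b k (φ k) else 0 := by
    intro u
    rw [Finset.prod_univ_sum, ← Finset.sum_filter]
    refine Finset.sum_congr ?_ fun _ _ => rfl
    ext φ
    simp only [Fintype.mem_piFinset, Finset.mem_compl, Finset.mem_filter, Finset.mem_univ,
      true_and, Finset.subset_iff, Finset.mem_image, not_exists]
    exact ⟨fun h x hx k hk => h k (hk ▸ hx), fun h k hk => h hk k rfl⟩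
  simp only [h1, Finset.mul_sum]
  rw [Finset.sum_comm]
  refine Finset.sum_congr rfl fun φ _ => ?_
  simp only [mul_ite, mul_zero]
  rw [← Finset.sum_filter, ← Finset.sum_mul]
  have h2 : Finset.univ.filter (fun u => u ⊆ (Finset.univ.image φ)ᶜ) =
      ((Finset.univ.image φ)ᶜ).powerset := by
    ext u
    simp
  have h3 : (∑ u ∈ ((Finset.univ.image φ)ᶜ).powerset, (-1 : ℝ) ^ u.card) =
      if (Finset.univ.image φ)ᶜ = ∅ then 1 else 0 := by
    have := Finset.sum_powerset_neg_one_pow_card (x := (Finset.univ.image φ)ᶜ)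
    exact_mod_cast congrArg (Int.cast : ℤ → ℝ) this
  have h4 : (Finset.univ.image φ)ᶜ = ∅ ↔ Function.Surjective φ := by
    rw [Finset.compl_eq_empty_iff, Finset.eq_univ_iff_forall]
    simp [Function.Surjective]
  rw [h2, h3]
  simp only [h4, ite_mul, one_mul, zero_mul]

/-- The polarization points: the sum of the coordinate vectors `e_{J l}` over `l ∈ s`. -/
def polarPoint {m d : ℕ} (J : Fin d → Fin m) (s : Finset (Fin d)) : Fin m → ℝ :=
  fun i => ∑ l ∈ s, if J l = i then 1 else 0

/-- The coefficients of a homogeneous polynomial are controlled by its values at the polarization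
points. -/
theorem abs_coeff_le_of_abs_blockPoly_le {m d t : ℕ}
    (α : EuclideanSpace ℝ (Fin t × SortedTuple d m)) (j : Fin t) (J : SortedTuple d m) {M : ℝ}
    (hM : ∀ s, |blockPoly α j (polarPoint J.1 s)| ≤ M) : |α (j, J)| ≤ 2 ^ d * M := by
  classical
  -- `N I` counts the permutations `φ` with `J ∘ φ = I`. As both tuples are sorted, it vanishes
  -- unless `I = J`, where the identity contributes 1.
  set N : SortedTuple d m → ℝ := fun I => ∑ φ : Fin d → Fin d,
    if Function.Surjective φ then ∏ k, (if J.1 (φ k) = I.1 k then (1 : ℝ) else 0) else 0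
  have h1 : ∑ u : Finset (Fin d), (-1) ^ u.card * blockPoly α j (polarPoint J.1 uᶜ) =
      ∑ I, α (j, I) * N I := by
    simp only [blockPoly, Finset.mul_sum]
    rw [Finset.sum_comm]
    refine Finset.sum_congr rfl fun I _ => ?_
    have hNI : N I = _ :=
      (sum_neg_one_pow_mul_prod_sum fun k l => if J.1 l = I.1 k then (1 : ℝ) else 0).symm
    rw [hNI, Finset.mul_sum]
    refine Finset.sum_congr rfl fun u _ => ?_
    simp only [polarPoint]
    ring
  have hN0 : ∀ I, I ≠ J → N I = 0 := by
    intro I hIJ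
    refine Finset.sum_eq_zero fun φ _ => ?_
    split_ifs with hφ
    · by_contra hne
      have h2 : ∀ k, J.1 (φ k) = I.1 k := by
        intro k
        by_contra hk
        exact hne (Finset.prod_eq_zero (Finset.mem_univ k) (if_neg hk))
      have hbij : Function.Bijective φ := Finite.injective_iff_bijective.1
        (Finite.injective_iff_surjective.2 hφ)
      let σ : Equiv.Perm (Fin d) := Equiv.ofBijective φ hbij
      have h3 : J.1 ∘ σ = I.1 := funext h2
      have h4 : J.1 ∘ σ = J.1 ∘ (1 : Equiv.Perm (Fin d)) := Tuple.unique_monotone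
        (by rw [h3]; exact fun k l hkl => I.2 k l hkl) (fun k l hkl => J.2 k l hkl)
      exact hIJ (Subtype.ext (h3.symm.trans h4))
    · rfl
  have hN1 : 1 ≤ N J := by
    refine le_trans ?_ (Finset.single_le_sum (fun φ _ => ?_) (Finset.mem_univ (id : Fin d → Fin d)))
    · simp [Function.surjective_id]
    · split_ifs
      · exact Finset.prod_nonneg fun k _ => by split_ifs <;> simp
      · exact le_rfl
  rw [Finset.sum_eq_single J (fun I _ h => by rw [hN0 I h, mul_zero]) (by simp)] at h1
  calc |α (j, J)| ≤ |α (j, J)| * N J := le_mul_of_one_le_right (abs_nonneg _) hN1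
    _ = |α (j, J) * N J| := by rw [abs_mul, abs_of_nonneg (zero_le_one.trans hN1)]
    _ ≤ ∑ u : Finset (Fin d), |(-1) ^ u.card * blockPoly α j (polarPoint J.1 uᶜ)| := by
        rw [← h1]
        exact Finset.abs_sum_le_sum_abs _ _
    _ ≤ ∑ u : Finset (Fin d), M := by
        refine Finset.sum_le_sum fun u _ => ?_
        rw [abs_mul, abs_pow, abs_neg, abs_one, one_pow, one_mul]
        exact hM _
    _ = 2 ^ d * M := by simp

theorem card_sortedTuple (d m : ℕ) :
    Fintype.card (SortedTuple d m) = (m + d - 1).choose d := by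
  have h := Sym.card_sym_eq_choose (α := Fin m) d
  rw [Fintype.card_fin] at h
  rw [← h]
  let F : SortedTuple d m → Sym (Fin m) d := fun I => ⟨(List.ofFn I.1 : Multiset (Fin m)), by simp⟩
  refine Fintype.card_of_bijective (f := F) ⟨fun I J hIJ => ?_, fun s => ?_⟩
  · have h1 : (List.ofFn I.1).Perm (List.ofFn J.1) :=
      Multiset.coe_eq_coe.1 (congrArg Subtype.val hIJ)
    have hs : ∀ K : SortedTuple d m, (List.ofFn K.1).Pairwise (· ≤ ·) := fun K =>
      List.pairwise_ofFn.2 fun k l hkl => K.2 k l hkl.le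
    exact Subtype.ext (List.ofFn_injective (h1.eq_of_pairwise' (hs I) (hs J)))
  · have hlen : (s.1.sort (· ≤ ·)).length = d := by simp
    refine ⟨⟨fun k => (s.1.sort (· ≤ ·)).get (k.cast hlen.symm), fun k l hkl => ?_⟩, ?_⟩
    · exact (Multiset.pairwise_sort s.1 (· ≤ ·)).rel_get_of_le hkl
    · refine Subtype.ext ?_
      conv_rhs => rw [← Multiset.sort_eq s.1 (· ≤ ·)]
      refine congrArg _ (List.ext_get (by simp) fun k h1 h2 => ?_)
      simp only [List.get_ofFn]
      rfl

/-! ### The bad event for a fixed block and point -/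

theorem continuous_symKronCol {X : Type*} [TopologicalSpace X] {n m d : ℕ}
    {U : X → Matrix (Fin n) (Fin m) ℝ} (hU : ∀ b i, Continuous fun x => U x b i)
    (I : SortedTuple d m) : Continuous fun x => symKronCol (U x) I := by
  refine Continuous.subtype_mk ?_ _
  unfold symProdTensor
  refine (PiLp.continuous_toLp 2 _).comp (continuous_pi fun a => ?_)
  exact continuous_const.mul (continuous_finsetSum _ fun π _ =>
    continuous_finsetProd _ fun k _ => hU _ _)

/-- For `T` in the image of the projection, pairing with `x` sees only the projection of `x`. Test
tensors from `S` therefore bound `‖Φ x‖` from below. -/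
theorem IsOrthogonalProjection.abs_inner_le {n d D : ℕ}
    {Φ : SymTensor n d →ₗ[ℝ] EuclideanSpace ℝ (Fin D)} (hΦ : IsOrthogonalProjection Φ) :
    ∃ S : Submodule ℝ (SymTensor n d), finrank ℝ (LinearMap.range Φ) ≤ finrank ℝ S ∧
      ∀ T ∈ S, ∀ x, |inner ℝ T x| ≤ ‖T‖ * ‖Φ x‖ := by
  obtain ⟨S, j, hj⟩ := hΦ
  refine ⟨S, ?_, fun T hT x => ?_⟩
  · have : LinearMap.range Φ ≤ LinearMap.range j.toLinearMap := by
      rintro _ ⟨T, rfl⟩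
      exact ⟨_, (hj T).symm⟩
    exact (Submodule.finrank_mono this).trans (LinearMap.finrank_range_le _)
  · rw [hj, j.norm_map]
    have h1 : inner ℝ T x = inner ℝ T (S.starProjection x) := by
      have := Submodule.inner_right_of_mem_orthogonal hT (S.sub_starProjection_mem_orthogonal x)
      rw [inner_sub_right, sub_eq_zero] at this
      exact this
    rw [h1]
    exact abs_real_inner_le_norm T _

/-- For a fixed direction `a` in the coefficient space of the block `j₀`, it is unlikely that some
coefficient vector whose `j₀`-th block does not vanish at `a` is almost annihilated. -/
theorem measure_exists_norm_lt_le {Ω : Type*} [MeasurableSpace Ω] {μ : Measure Ω}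
    [IsProbabilityMeasure μ] {n m d t D : ℕ} [NeZero n]
    {Φ : SymTensor n (d + 1) →ₗ[ℝ] EuclideanSpace ℝ (Fin D)} (hΦ : IsOrthogonalProjection Φ)
    {ρ : ℝ} (hρ : 0 < ρ) {U : Fin t → Matrix (Fin n) (Fin m) ℝ}
    {Ut : Ω → Fin t → Matrix (Fin n) (Fin m) ℝ} (hUt : AreIndepPerturbations μ ρ U Ut)
    (j₀ : Fin t) (a : Fin m → ℝ) (ha : 0 < ∑ i, a i ^ 2) {A : ℝ} (hA : 0 ≤ A)
    (haA : ∑ i, a i ^ 2 ≤ A ^ 2) {K : ℕ} (hK : 1 ≤ K)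
    (hdim : K * 4 ^ (d + 1) * n ^ (d + 1) +
      n * (t * Fintype.card (SortedTuple (d + 1) m) + m * n ^ d) ≤
      n * finrank ℝ (LinearMap.range Φ))
    {β γ : ℝ} (hβ : 0 < β) (hβγ : A / ρ * (2 * ((d + 1 : ℕ) + 2) ^ 2 * √(2 * n) * β) ≤ γ) :
    μ {ω | ∃ α, blockPoly α j₀ a = 1 ∧ ‖Φ (blockSymKron (Ut ω) α)‖ < β ^ (d + 1) / 2} ≤
      (K + 1) ^ (d + 1) * ENNReal.ofReal γ ^ K := by
  classical
  set s := ∑ i, a i ^ 2 with hs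
  set ε := β ^ (d + 1) / 2
  obtain ⟨S, hSfin, hS⟩ := hΦ.abs_inner_le
  let X : Fin t × Fin n × Fin m → Ω → ℝ := fun p ω => Ut ω p.1 p.2.1 p.2.2 - U p.1 p.2.1 p.2.2
  -- `c b` is `a` placed in row `b` of block `j₀`, so the component along these vectors is `h aᵀ`
  -- and each `h b` has variance `ρ ^ 2 / s`.
  let c : Fin n → Fin t × Fin n × Fin m → ℝ := fun b p =>
    if p.1 = j₀ then (if p.2.1 = b then a p.2.2 else 0) else 0
  have hc : ∀ b b', ∑ p, c b p * c b' p = if b = b' then s else 0 := by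
    intro b b'
    rw [Fintype.sum_prod_type, Finset.sum_eq_single j₀ (fun j _ hj => by simp [c, hj]) (by simp),
      Fintype.sum_prod_type, Finset.sum_eq_single b (fun i _ hi => by simp [c, hi]) (by simp)]
    by_cases hb : b = b'
    · simp [c, hb, hs, sq]
    · simp [c, hb]
  let v' : ℝ≥0 := (ρ ^ 2 / s).toNNReal
  have hv' : (v' : ℝ) = ρ ^ 2 / s := Real.coe_toNNReal _ (by positivity)
  have hv'0 : v' ≠ 0 := by
    rw [← NNReal.coe_ne_zero, hv']
    positivity
  let V : (Fin n → ℝ) × (Fin t × Fin n × Fin m → ℝ) → Fin t → Matrix (Fin n) (Fin m) ℝ :=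
    fun y j b i => U j b i + y.2 (j, b, i) + if j = j₀ then a i * y.1 b else 0
  let E : Set ((Fin n → ℝ) × (Fin t × Fin n × Fin m → ℝ)) :=
    {y | ∃ α, blockPoly α j₀ a = 1 ∧ ‖Φ (blockSymKron (V y) α)‖ < ε}
  -- Measurability despite the uncountable quantifier over `α`: a union of open sets is open.
  have hE : IsOpen E := by
    have : E = ⋃ α ∈ {α : EuclideanSpace ℝ (Fin t × SortedTuple (d + 1) m) |
        blockPoly α j₀ a = 1}, {y | ‖Φ (blockSymKron (V y) α)‖ < ε} := by
      ext y
      simp [E]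
    rw [this]
    refine isOpen_biUnion fun α _ => isOpen_lt (Continuous.norm ?_) continuous_const
    refine Φ.continuous_of_finiteDimensional.comp ?_
    refine continuous_finsetSum _ fun p _ => ?_
    have hcont : Continuous fun y => symKronCol (V y p.1) p.2 := by
      refine continuous_symKronCol (fun b i => ?_) _
      simp only [V]
      split_ifs <;> fun_prop
    exact hcont.const_smul (α p)
  have hsec : ∀ w, Measure.pi (fun _ : Fin n => gaussianReal 0 v') {h | (h, w) ∈ E} ≤
      (K + 1) ^ (d + 1) * ENNReal.ofReal γ ^ K := by
    intro w
    obtain ⟨R, hRS, hRfin, hR⟩ := exists_submodule_inner_blockSymKron S (V (0, w)) j₀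
      (fun b i => U j₀ b i + w (j₀, b, i))
    have hsub : {h | (h, w) ∈ E} ⊆ smallSet (R.map (SymTensor n (d + 1)).subtype) ε := by
      rintro h ⟨α, hα, hlt⟩ _ ⟨T, hT, rfl⟩
      have h1 := hR h a (V (h, w)) (fun j hj => by ext b i; simp [V, hj])
        (fun b i => by simp [V]; ring) α T hT
      rw [hα, one_mul] at h1
      have h2 := hS T (hRS hT) (blockSymKron (V (h, w)) α)
      rw [h1] at h2
      refine h2.trans ?_
      rw [mul_comm]
      exact mul_le_mul_of_nonneg_right hlt.le (norm_nonneg _)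
    refine (measure_mono hsub).trans (measure_smallSet_le (gaussianReal 0 v') (by positivity) hβ
      (gaussianReal_le_volume 0 hv'0 (L := A / ρ) ?_) hK (d + 1) hβγ _
      (Submodule.map_subtype_le _ _) ?_)
    -- The inverse standard deviation of `h b` is `√s / ρ`, at most `A / ρ`.
    · rw [hv', Real.sqrt_div (by positivity), Real.sqrt_sq hρ.le, one_div_div]
      gcongr
      rw [← Real.sqrt_sq hA]
      exact Real.sqrt_le_sqrt haA
    · rw [Submodule.finrank_map_subtype_eq]
      have := Nat.mul_le_mul_left n (hSfin.trans hRfin)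
      rw [mul_add] at this
      omega
  have hmain := measure_gaussian_split_le (X := X) (fun p => hUt.1 p.1 p.2.1 p.2.2) hUt.2 c ha hc
    (v' := v') (by rw [hv']; rfl) hE.measurableSet hsec
  refine (measure_mono ?_).trans hmain
  rintro ω ⟨α, hα, hlt⟩
  have hV : V (fun b => ∑ p, s⁻¹ * c b p * X p ω,
      fun p => X p ω - ∑ b, c b p * ∑ p', s⁻¹ * c b p' * X p' ω) = Ut ω := by
    ext j b i
    simp only [V]
    have h1 : ∀ f : Fin n → ℝ, ∑ b', c b' (j, b, i) * f b' = if j = j₀ then a i * f b else 0 := by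
      intro f
      by_cases hj : j = j₀ <;> simp [c, hj]
    rw [h1]
    simp only [X]
    ring
  refine ⟨α, hα, ?_⟩
  rwa [hV]

/-! ### From coefficient bounds to the least singular value -/

/-- Evaluate the bound at a right singular vector. In the count from 0, the last index is `k - 1`.
-/
theorem le_sigma_of_forall_le_norm {E F : Type*} [NormedAddCommGroup E] [InnerProductSpace ℝ E]
    [FiniteDimensional ℝ E] [NormedAddCommGroup F] [InnerProductSpace ℝ F] [FiniteDimensional ℝ F]
    {A : E →ₗ[ℝ] F} {κ : ℝ} (hA : ∀ x, κ * ‖x‖ ≤ ‖A x‖) {k : ℕ} (hk : finrank ℝ E = k)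
    (hk0 : 0 < k) : κ ≤ sigma k A := by
  obtain ⟨v, hv⟩ := (A.hasEigenvalue_adjoint_comp_self_sq_singularValues
    (n := k - 1) (by omega)).exists_hasEigenvector
  have hv0 : 0 < ‖v‖ := norm_pos_iff.2 hv.2
  have h1 : ‖A v‖ ^ 2 = (A.singularValues (k - 1) * ‖v‖) ^ 2 := by
    have h2 := hv.apply_eq_smul
    rw [← real_inner_self_eq_norm_sq, ← LinearMap.adjoint_inner_left, ← LinearMap.comp_apply, h2,
      mul_pow, ← real_inner_self_eq_norm_sq v, inner_smul_left]
    simp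
  have h3 : ‖A v‖ = A.singularValues (k - 1) * ‖v‖ :=
    (pow_left_inj₀ (norm_nonneg _) (mul_nonneg (A.singularValues_nonneg _) hv0.le)
      two_ne_zero).1 h1
  exact le_of_mul_le_mul_right (h3 ▸ hA v) hv0

theorem le_sigma_of_forall_abs_coord_le {ι F : Type*} [Fintype ι] [Nonempty ι]
    [NormedAddCommGroup F] [InnerProductSpace ℝ F] [FiniteDimensional ℝ F]
    {A : EuclideanSpace ℝ ι →ₗ[ℝ] F} {ε M : ℝ} (hε : 0 < ε) (hM : 0 < M)
    (hA : ∀ α p, ε * |α p| ≤ M * ‖A α‖) :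
    ε / (M * √(Fintype.card ι)) ≤ sigma (Fintype.card ι) A := by
  have hc : (0 : ℝ) < Fintype.card ι := by exact_mod_cast Fintype.card_pos
  refine le_sigma_of_forall_le_norm (fun α => ?_) (by simp) Fintype.card_pos
  rw [div_mul_eq_mul_div, div_le_iff₀ (mul_pos hM (Real.sqrt_pos.2 hc))]
  refine le_of_sq_le_sq ?_ (by positivity)
  rw [mul_pow, EuclideanSpace.norm_sq_eq, Finset.mul_sum]
  calc ∑ p, ε ^ 2 * ‖α p‖ ^ 2 ≤ ∑ _p : ι, (M * ‖A α‖) ^ 2 := by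
        refine Finset.sum_le_sum fun p _ => ?_
        rw [← mul_pow, Real.norm_eq_abs]
        exact pow_le_pow_left₀ (by positivity) (hA α p) 2
    _ = (‖A α‖ * (M * √(Fintype.card ι))) ^ 2 := by
        rw [Finset.sum_const, Finset.card_univ, nsmul_eq_mul]
        simp only [mul_pow, Real.sq_sqrt hc.le]
        ring

theorem blockPoly_smul {m d t : ℕ} (r : ℝ) (α : EuclideanSpace ℝ (Fin t × SortedTuple d m))
    (j : Fin t) (a : Fin m → ℝ) : blockPoly (r • α) j a = r * blockPoly α j a := by
  simp [blockPoly, Finset.mul_sum, mul_assoc]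

theorem blockPoly_zero {m d t : ℕ} (α : EuclideanSpace ℝ (Fin t × SortedTuple (d + 1) m))
    (j : Fin t) : blockPoly α j 0 = 0 := by
  simp [blockPoly]

/-- If no coefficient vector with a block of value `1` at a polarization point is almost
annihilated, then the least singular value is large. -/
theorem le_sigma_blockSymKron {n m d t D : ℕ} [NeZero m] [NeZero t]
    (Φ : SymTensor n (d + 1) →ₗ[ℝ] EuclideanSpace ℝ (Fin D))
    (V : Fin t → Matrix (Fin n) (Fin m) ℝ) {ε : ℝ} (hε : 0 < ε)
    (h : ∀ j (J : SortedTuple (d + 1) m) s, 0 < ∑ i, polarPoint J.1 s i ^ 2 →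
      ∀ α, blockPoly α j (polarPoint J.1 s) = 1 → ε ≤ ‖Φ (blockSymKron V α)‖) :
    ε / (2 ^ (d + 1) * √(t * Fintype.card (SortedTuple (d + 1) m) : ℕ)) ≤
      sigma (t * (m + (d + 1) - 1).choose (d + 1)) (Φ ∘ₗ blockSymKron V) := by
  have hcard : t * Fintype.card (SortedTuple (d + 1) m) =
      Fintype.card (Fin t × SortedTuple (d + 1) m) := by simp
  have : Nonempty (SortedTuple (d + 1) m) := ⟨⟨fun _ => 0, fun _ _ _ => le_rfl⟩⟩
  rw [← card_sortedTuple, hcard]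
  refine le_sigma_of_forall_abs_coord_le hε (by positivity) ?_
  rintro α ⟨j, J⟩
  rw [LinearMap.comp_apply, ← div_mul_cancel₀ ‖Φ (blockSymKron V α)‖ hε.ne', mul_comm ε,
    ← mul_assoc]
  refine mul_le_mul_of_nonneg_right ?_ hε.le
  refine abs_coeff_le_of_abs_blockPoly_le α j J fun s => ?_
  set a := polarPoint J.1 s with ha
  set x := blockPoly α j a with hx
  rw [le_div_iff₀ hε]
  by_cases hx0 : x = 0
  · rw [hx0, abs_zero, zero_mul]
    exact norm_nonneg _
  have ha0 : 0 < ∑ i, a i ^ 2 := by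
    refine lt_of_le_of_ne (Finset.sum_nonneg fun i _ => sq_nonneg _) fun h0 => hx0 ?_
    have : a = 0 := by
      ext i
      exact pow_eq_zero_iff two_ne_zero |>.1
        ((Finset.sum_eq_zero_iff_of_nonneg fun i _ => sq_nonneg _).1 h0.symm i (Finset.mem_univ i))
    rw [hx, this, blockPoly_zero]
  -- By homogeneity in `α`, the block value can be scaled to 1.
  have h1 := h j J s ha0 (x⁻¹ • α) (by rw [blockPoly_smul]; exact inv_mul_cancel₀ hx0)
  rw [map_smul, map_smul, norm_smul, norm_inv, Real.norm_eq_abs] at h1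
  rw [inv_mul_eq_div, le_div_iff₀ (abs_pos.2 hx0)] at h1
  linarith

/-! ### Numerical estimates, union bound and choice of parameters -/

theorem sum_sq_polarPoint_le {m d : ℕ} (J : Fin d → Fin m) (s : Finset (Fin d)) :
    ∑ i, polarPoint J s i ^ 2 ≤ (d : ℝ) ^ 2 := by
  have h0 : ∀ i, 0 ≤ polarPoint J s i := fun i =>
    Finset.sum_nonneg fun l _ => by split_ifs <;> simp
  have h1 : ∑ i, polarPoint J s i = s.card := by
    simp only [polarPoint]
    rw [Finset.sum_comm]
    simp
  have h2 : (s.card : ℝ) ≤ d := by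
    exact_mod_cast (Finset.card_le_univ s).trans_eq (Fintype.card_fin d)
  calc ∑ i, polarPoint J s i ^ 2 ≤ (∑ i, polarPoint J s i) ^ 2 :=
        Finset.sum_sq_le_sq_sum_of_nonneg fun i _ => h0 i
    _ ≤ _ := by
        rw [h1]
        gcongr

theorem pow_le_factorial_mul_choose (n d : ℕ) (hn : 1 ≤ n) :
    n ^ d ≤ d.factorial * (n + d - 1).choose d := by
  obtain ⟨n, rfl⟩ := Nat.exists_eq_add_of_le' hn
  rw [← Nat.ascFactorial_eq_factorial_mul_choose']
  exact Nat.pow_succ_le_ascFactorial (n + 1) d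

theorem choose_le_pow_card (n d : ℕ) : (n + d - 1).choose d ≤ n ^ d := by
  rw [← card_sortedTuple]
  exact (Fintype.card_subtype_le _).trans_eq (by simp)

/-- Here `K - 3 * d ≥ K / 2`, and `n ≥ 3` exceeds `e`. -/
theorem pow_div_pow_le_exp {n d K : ℕ} (hn : 3 ≤ n) (hK : 6 * d ≤ K) :
    (n : ℝ) ^ (3 * d) * (1 / n) ^ K ≤ Real.exp (-(K / 2)) := by
  have hn0 : (0 : ℝ) < n := by positivity
  have hn3 : Real.exp 1 ≤ n := by
    have : (3 : ℝ) ≤ n := by exact_mod_cast hn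
    linarith [Real.exp_one_lt_d9]
  obtain ⟨r, rfl⟩ := Nat.exists_eq_add_of_le (show 3 * d ≤ K by omega)
  have h1 : Real.exp r ≤ (n : ℝ) ^ r := by
    rw [← mul_one (r : ℝ), Real.exp_nat_mul]
    exact pow_le_pow_left₀ (Real.exp_pos 1).le hn3 r
  have h2 : (((3 * d + r : ℕ) : ℝ) / 2) ≤ r := by
    have : 3 * d ≤ r := by omega
    have : (3 : ℝ) * d ≤ r := by exact_mod_cast this
    push_cast
    linarith
  calc (n : ℝ) ^ (3 * d) * (1 / n) ^ (3 * d + r) = ((n : ℝ) ^ r)⁻¹ := by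
        rw [one_div, pow_add, inv_pow, inv_pow]
        field_simp
    _ ≤ (Real.exp r)⁻¹ := inv_anti₀ (Real.exp_pos _) h1
    _ = Real.exp (-r) := (Real.exp_neg _).symm
    _ ≤ _ := Real.exp_le_exp.2 (by linarith)

/-- Polarization points have norm at most `d`, whence the density bound `d / ρ`; the step `β = ρ / n
^ 3` leaves a spare factor `1 / n` to serve as `γ`. -/
theorem density_mul_step_le {n d : ℕ} {ρ : ℝ} (hρ : 0 < ρ)
    (hn : 4 * d * ((d : ℝ) + 2) ^ 2 ≤ n) [NeZero n] :
    (d : ℝ) / ρ * (2 * ((d : ℝ) + 2) ^ 2 * √(2 * n) * (ρ / (n : ℝ) ^ 3)) ≤ 1 / n := by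
  have hn1 : (1 : ℝ) ≤ n := by exact_mod_cast Nat.one_le_iff_ne_zero.2 (NeZero.ne n)
  have hsqrt : √(2 * n : ℝ) ≤ 2 * n := by
    rw [Real.sqrt_le_left (by positivity)]
    nlinarith
  calc (d : ℝ) / ρ * (2 * ((d : ℝ) + 2) ^ 2 * √(2 * n) * (ρ / (n : ℝ) ^ 3))
      ≤ (d : ℝ) / ρ * (2 * ((d : ℝ) + 2) ^ 2 * (2 * n) * (ρ / (n : ℝ) ^ 3)) := by gcongr
    _ = 4 * d * ((d : ℝ) + 2) ^ 2 / (n : ℝ) ^ 2 := by field_simp; ring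
    _ ≤ n / (n : ℝ) ^ 2 := by gcongr
    _ = 1 / n := by field_simp

/-- The exponent `5 * d` is `3 * d` from `β = ρ / n ^ 3`, `d` to absorb `2 * 2 ^ d`, and `d` to
absorb `√N`. -/
theorem threshold_le {n d t N : ℕ} {ρ : ℝ} (hρ : 0 < ρ) (hd : 1 ≤ d) (hn : 4 ≤ n) (ht : 1 ≤ t)
    (hN : 1 ≤ N) (hNn : (N : ℝ) ≤ (n : ℝ) ^ d) :
    ρ ^ d / (√(t : ℝ) * (n : ℝ) ^ (5 * d)) ≤
      (ρ / (n : ℝ) ^ 3) ^ d / 2 / (2 ^ d * √((t * N : ℕ) : ℝ)) := by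
  have hn4 : (4 : ℝ) ≤ n := by exact_mod_cast hn
  have hN1 : (1 : ℝ) ≤ N := by exact_mod_cast hN
  have hsq : √((t * N : ℕ) : ℝ) ≤ √t * (n : ℝ) ^ d := by
    rw [Nat.cast_mul, Real.sqrt_mul (by positivity)]
    gcongr
    refine le_trans ?_ hNn
    rw [Real.sqrt_le_left (by positivity)]
    nlinarith
  have h22 : (2 : ℝ) * 2 ^ d ≤ (n : ℝ) ^ d := by
    calc (2 : ℝ) * 2 ^ d ≤ 2 ^ d * 2 ^ d := by
          gcongr
          exact le_self_pow₀ (by norm_num) (by omega)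
      _ = 4 ^ d := by rw [← mul_pow]; norm_num
      _ ≤ _ := by gcongr
  have hden : (n : ℝ) ^ (3 * d) * 2 * (2 ^ d * √((t * N : ℕ) : ℝ)) ≤ √t * (n : ℝ) ^ (5 * d) := by
    calc (n : ℝ) ^ (3 * d) * 2 * (2 ^ d * √((t * N : ℕ) : ℝ))
        = (n : ℝ) ^ (3 * d) * (2 * 2 ^ d) * √((t * N : ℕ) : ℝ) := by ring
      _ ≤ (n : ℝ) ^ (3 * d) * (n : ℝ) ^ d * (√t * (n : ℝ) ^ d) := by gcongr
      _ = _ := by ring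
  have hrw : (ρ / (n : ℝ) ^ 3) ^ d / 2 / (2 ^ d * √((t * N : ℕ) : ℝ)) =
      ρ ^ d / ((n : ℝ) ^ (3 * d) * 2 * (2 ^ d * √((t * N : ℕ) : ℝ))) := by
    rw [div_pow, ← pow_mul, div_div, div_div]
    ring
  have hsqpos : 0 < √((t * N : ℕ) : ℝ) := Real.sqrt_pos.2 (by exact_mod_cast Nat.mul_pos ht hN)
  rw [hrw]
  exact div_le_div_of_nonneg_left (by positivity) (by positivity) hden

/-- The probability that the least singular value is large, with explicit parameters. -/
theorem measureReal_le_sigma {Ω : Type*} [MeasurableSpace Ω] {μ : Measure Ω}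
    [IsProbabilityMeasure μ] {n m d t D : ℕ} [NeZero n] [NeZero m] [NeZero t]
    {Φ : SymTensor n (d + 1) →ₗ[ℝ] EuclideanSpace ℝ (Fin D)} (hΦ : IsOrthogonalProjection Φ)
    {ρ : ℝ} (hρ : 0 < ρ) {U : Fin t → Matrix (Fin n) (Fin m) ℝ}
    {Ut : Ω → Fin t → Matrix (Fin n) (Fin m) ℝ} (hUt : AreIndepPerturbations μ ρ U Ut)
    {K : ℕ} (hK : 1 ≤ K)
    (hdim : K * 4 ^ (d + 1) * n ^ (d + 1) +
      n * (t * (m + (d + 1) - 1).choose (d + 1) + m * n ^ d) ≤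
      n * finrank ℝ (LinearMap.range Φ))
    {β γ : ℝ} (hβ : 0 < β) (hγ : 0 ≤ γ)
    (hβγ : (d + 1 : ℕ) / ρ * (2 * ((d + 1 : ℕ) + 2) ^ 2 * √(2 * n) * β) ≤ γ) :
    1 - (t * (m + (d + 1) - 1).choose (d + 1) * 2 ^ (d + 1) : ℕ) *
        ((K + 1) ^ (d + 1) * γ ^ K) ≤
      μ.real {ω | β ^ (d + 1) / 2 /
          (2 ^ (d + 1) * √(t * (m + (d + 1) - 1).choose (d + 1) : ℕ)) ≤
        sigma (t * (m + (d + 1) - 1).choose (d + 1)) (Φ ∘ₗ blockSymKron (Ut ω))} := by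
  classical
  set good := {ω | β ^ (d + 1) / 2 /
      (2 ^ (d + 1) * √(t * (m + (d + 1) - 1).choose (d + 1) : ℕ)) ≤
    sigma (t * (m + (d + 1) - 1).choose (d + 1)) (Φ ∘ₗ blockSymKron (Ut ω))}
  -- One bad event per block, coefficient and polarization point. The zero point is excluded, since
  -- it gives no direction to split along.
  let B : Fin t × SortedTuple (d + 1) m × Finset (Fin (d + 1)) → Set Ω := fun p =>
    {ω | 0 < ∑ i, polarPoint p.2.1.1 p.2.2 i ^ 2 ∧
      ∃ α, blockPoly α p.1 (polarPoint p.2.1.1 p.2.2) = 1 ∧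
        ‖Φ (blockSymKron (Ut ω) α)‖ < β ^ (d + 1) / 2}
  have hB : ∀ p, μ.real (B p) ≤ (K + 1) ^ (d + 1) * γ ^ K := by
    intro p
    refine ENNReal.toReal_le_of_le_ofReal (by positivity) ?_
    rw [ENNReal.ofReal_mul (by positivity), ENNReal.ofReal_pow (by positivity),
      ENNReal.ofReal_pow hγ, ENNReal.ofReal_add (by positivity) zero_le_one,
      ENNReal.ofReal_natCast, ENNReal.ofReal_one]
    by_cases ha : 0 < ∑ i, polarPoint p.2.1.1 p.2.2 i ^ 2
    · refine (measure_mono fun ω hω => hω.2).trans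
        (measure_exists_norm_lt_le hΦ hρ hUt p.1 _ ha (by positivity) (sum_sq_polarPoint_le _ _)
          hK ?_ hβ hβγ)
      rwa [card_sortedTuple]
    · have : B p = ∅ := by
        ext ω
        exact ⟨fun h => ha h.1, fun h => h.elim⟩
      simp [this]
  have hcover : (Set.univ : Set Ω) ⊆ good ∪ ⋃ p, B p := by
    intro ω _
    by_contra hω
    simp only [Set.mem_union, Set.mem_iUnion, not_or, not_exists] at hω
    refine hω.1 ?_
    have := le_sigma_blockSymKron Φ (Ut ω) (ε := β ^ (d + 1) / 2) (by positivity)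
      fun j J s hs α hα => not_lt.1 fun hlt => hω.2 (j, J, s) ⟨hs, α, hα, hlt⟩
    rwa [card_sortedTuple] at this
  have h1 : (1 : ℝ) ≤ μ.real good + μ.real (⋃ p, B p) := by
    have := (measureReal_mono (μ := μ) hcover).trans (measureReal_union_le _ _)
    rwa [probReal_univ] at this
  have h2 : μ.real (⋃ p, B p) ≤ (t * (m + (d + 1) - 1).choose (d + 1) * 2 ^ (d + 1) : ℕ) *
      ((K + 1) ^ (d + 1) * γ ^ K) := by
    refine (measureReal_iUnion_fintype_le B).trans ((Finset.sum_le_sum fun p _ => hB p).trans ?_)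
    rw [Finset.sum_const, Finset.card_univ, nsmul_eq_mul, Fintype.card_prod, Fintype.card_prod,
      card_sortedTuple, Fintype.card_finset, Fintype.card_fin, Fintype.card_fin, mul_assoc t]
  linarith

theorem corollary5p3 :
    -- the exponent `O(d)` of `n` is `C * d` with `C` absolute
    ∃ C : ℕ, ∀ d : ℕ, 1 ≤ d → ∃ c_d : ℝ, 0 < c_d ∧
      ∀ δ₁ δ₂ : ℝ, 0 < δ₂ → δ₂ < δ₁ → δ₁ ≤ 1 →
        -- `c` is the constant in `Ω_{d,δ₁,δ₂}(n)`
        ∃ c : ℝ, 0 < c ∧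
          ∀ (n m t D : ℕ), 1 ≤ m → 1 ≤ t →
          ∀ (Φ : SymTensor n d →ₗ[ℝ] EuclideanSpace ℝ (Fin D)), IsOrthogonalProjection Φ →
            δ₁ * ((n + d - 1).choose d : ℝ) ≤ (finrank ℝ (LinearMap.range Φ) : ℝ) →
          (t : ℝ) * ((m + d - 1).choose d : ℝ) ≤ δ₂ * ((n + d - 1).choose d : ℝ) →
          (m : ℝ) ≤ c_d * (δ₁ - δ₂) * (n : ℝ) →
          ∀ (ρ : ℝ), 0 < ρ →
          ∀ (U : Fin t → Matrix (Fin n) (Fin m) ℝ)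
            (Ω : Type*) [MeasurableSpace Ω] (μ : Measure Ω) [IsProbabilityMeasure μ]
            (Ut : Ω → Fin t → Matrix (Fin n) (Fin m) ℝ), AreIndepPerturbations μ ρ U Ut →
            1 - Real.exp (-(c * (n : ℝ))) ≤
              μ.real {ω | ρ ^ d / (√(t : ℝ) * (n : ℝ) ^ (C * d)) ≤
                sigma (t * (m + d - 1).choose d) (Φ ∘ₗ blockSymKron (d := d) (Ut ω))} := by
  refine ⟨5, fun d hd => ?_⟩
  obtain ⟨e, rfl⟩ := Nat.exists_eq_add_of_le' hd
  set d := e + 1 with hde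
  have hd1 : (1 : ℝ) ≤ d := by exact_mod_cast hd
  set P : ℝ := 4 ^ d * d.factorial with hP
  have hfac : (1 : ℝ) ≤ d.factorial := by exact_mod_cast Nat.one_le_iff_ne_zero.2 d.factorial_ne_zero
  have h4d : (4 : ℝ) ≤ 4 ^ d := by
    calc (4 : ℝ) = 4 ^ 1 := by norm_num
      _ ≤ 4 ^ d := pow_le_pow_right₀ (by norm_num) hd
  have hPfac : (d.factorial : ℝ) ≤ P := by
    rw [hP]; exact le_mul_of_one_le_left (by linarith) (by linarith)
  have hP4 : 4 ≤ P := by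
    rw [hP]; nlinarith
  -- Large enough for `6 * d ≤ K`, for the density bound, and for `m * n ^ d` to fit in half the
  -- dimension slack.
  set Q : ℝ := 24 * d * P * (d + 2) ^ 2 with hQ
  have hd2 : (9 : ℝ) ≤ (d + 2) ^ 2 := by nlinarith
  have hdP : P ≤ d * P := le_mul_of_one_le_left (by linarith) hd1
  have hQ1 : 24 * (d * P) ≤ Q := by
    rw [hQ]; nlinarith
  have hQ2 : 4 * d * (d + 2) ^ 2 ≤ Q := by
    have : (0 : ℝ) ≤ d * (d + 2) ^ 2 := by positivity
    rw [hQ]; nlinarith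
  have hQpos : 0 < Q := by positivity
  refine ⟨1 / Q, by positivity, fun δ₁ δ₂ hδ₂ hδ hδ₁ => ?_⟩
  set Δ := δ₁ - δ₂ with hΔ
  have hΔ0 : 0 < Δ := sub_pos.2 hδ
  have hΔ1 : Δ ≤ 1 := by linarith
  -- The failure probability will be at most `exp (-K / 2)` with `K ≥ Δ * n / (4 * P)`.
  refine ⟨Δ / (8 * P), by positivity, ?_⟩
  intro n m t D hm ht Φ hΦ hrank htN hmn ρ hρ U Ω _ μ _ Ut hUt
  have hm1 : (1 : ℝ) ≤ m := by exact_mod_cast hm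
  have ht1 : (1 : ℝ) ≤ t := by exact_mod_cast ht
  have hmQ : (m : ℝ) * Q ≤ Δ * n := by
    have : 1 / Q * Δ * n = Δ * n / Q := by ring
    rw [this, le_div_iff₀ hQpos] at hmn
    exact hmn
  -- Since `m ≥ 1`, the bound on `m` already forces `n` to be large; small `n` needs no separate
  -- treatment.
  have hQn : Q ≤ Δ * n := (le_mul_of_one_le_left hQpos.le hm1).trans hmQ
  have hn0 : (0 : ℝ) ≤ n := Nat.cast_nonneg n
  have hΔn : Δ * n ≤ n := mul_le_of_le_one_left hn0 hΔ1
  have hn96 : (96 : ℝ) ≤ n := by linarith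
  have hnN : 96 ≤ n := by exact_mod_cast hn96
  have : NeZero n := ⟨by omega⟩
  have : NeZero m := ⟨by omega⟩
  have : NeZero t := ⟨by omega⟩
  set N : ℕ := (n + d - 1).choose d with hN
  set Nm : ℕ := (m + d - 1).choose d with hNm
  have hN_low : (n : ℝ) ^ d ≤ d.factorial * N := by
    exact_mod_cast pow_le_factorial_mul_choose n d (by omega)
  have hN_up : (N : ℝ) ≤ (n : ℝ) ^ d := by exact_mod_cast choose_le_pow_card n d
  have hNpos : (0 : ℝ) ≤ N := Nat.cast_nonneg N
  have htNm : (t : ℝ) * Nm ≤ (n : ℝ) ^ d :=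
    htN.trans ((mul_le_of_le_one_left hNpos (by linarith)).trans hN_up)
  have hNm0 : (0 : ℝ) ≤ Nm := Nat.cast_nonneg Nm
  have hNm_up : (Nm : ℝ) ≤ (n : ℝ) ^ d := (le_mul_of_one_le_left hNm0 ht1).trans htNm
  -- the number of exposed coordinates
  set x : ℝ := Δ * n / (2 * P) with hx
  have hx2 : 2 ≤ x := by
    rw [hx, le_div_iff₀ (by positivity)]; linarith
  set K : ℕ := ⌊x⌋₊ with hK
  have hKx : (K : ℝ) ≤ x := Nat.floor_le (by linarith)
  have hxK : x / 2 ≤ K := by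
    have := Nat.lt_floor_add_one x
    rw [← hK] at this
    linarith
  have hK6 : 6 * d ≤ K := by
    have h1 : (6 * d : ℝ) ≤ x / 2 := by
      rw [hx, div_div, le_div_iff₀ (by positivity)]
      linarith
    exact_mod_cast h1.trans hxK
  have hKn : ((K : ℝ) + 1) ≤ n := by
    have : x ≤ n / 8 := by
      rw [hx, div_le_div_iff₀ (by positivity) (by norm_num)]
      nlinarith
    linarith
  have hKP : (K : ℝ) * (2 * P) ≤ Δ * n := by
    have := mul_le_mul_of_nonneg_right hKx (by positivity : 0 ≤ 2 * P)
    rwa [hx, div_mul_cancel₀ _ (by positivity)] at this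
  -- The slack `Δ * n * N` is shared equally between the exposed coordinates and the contractions
  -- with `W`; the columns of the blocks use up `δ₂`.
  have hdim : K * 4 ^ (e + 1) * n ^ (e + 1) + n * (t * Nm + m * n ^ e) ≤
      n * finrank ℝ (LinearMap.range Φ) := by
    have h1 : (K : ℝ) * 4 ^ d * n ^ d ≤ Δ * n * N / 2 := by
      calc (K : ℝ) * 4 ^ d * n ^ d ≤ K * 4 ^ d * (d.factorial * N) := by gcongr
        _ = K * (2 * P) * N / 2 := by rw [hP]; ring
        _ ≤ _ := by gcongr
    have h2 : (m : ℝ) * n ^ d ≤ Δ * n * N / 2 := by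
      have h3 : 2 * (d.factorial : ℝ) ≤ Q := by linarith
      calc (m : ℝ) * n ^ d ≤ m * (d.factorial * N) := by gcongr
        _ = m * (2 * d.factorial) * N / 2 := by ring
        _ ≤ m * Q * N / 2 := by gcongr
        _ ≤ _ := by gcongr
    have h3 : (n : ℝ) * (t * Nm) ≤ n * (δ₂ * N) := by gcongr
    have h4 : (n : ℝ) * (δ₁ * N) ≤ n * finrank ℝ (LinearMap.range Φ) := by gcongr
    have h5 : (n : ℝ) * (m * n ^ e) = m * n ^ d := by rw [hde]; ring
    have h6 : (K : ℝ) * 4 ^ d * n ^ d + n * (t * Nm + m * n ^ e) ≤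
        n * finrank ℝ (LinearMap.range Φ) := by
      rw [mul_add, h5]
      have : Δ * n * N = n * (δ₁ * N) - n * (δ₂ * N) := by rw [hΔ]; ring
      linarith
    exact_mod_cast h6
  have hβγ := density_mul_step_le hρ (hQ2.trans (hQn.trans hΔn))
  have hmain := measureReal_le_sigma hΦ hρ hUt (K := K) (by omega) hdim (β := ρ / n ^ 3)
    (γ := 1 / n) (by positivity) (by positivity) hβγ
  -- The number of bad events is at most `n ^ (2 * d)` and `(K + 1) ^ d ≤ n ^ d`, both negligible
  -- against `n ^ K`.
  have hfail : ((t * Nm * 2 ^ d : ℕ) : ℝ) * (((K : ℝ) + 1) ^ d * (1 / n) ^ K) ≤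
      Real.exp (-(Δ / (8 * P) * n)) := by
    have h2d : (2 : ℝ) ^ d ≤ (n : ℝ) ^ d := by gcongr; linarith
    calc ((t * Nm * 2 ^ d : ℕ) : ℝ) * (((K : ℝ) + 1) ^ d * (1 / n) ^ K)
        = (t * Nm) * 2 ^ d * (((K : ℝ) + 1) ^ d * (1 / n) ^ K) := by push_cast; ring
      _ ≤ (n : ℝ) ^ d * (n : ℝ) ^ d * ((n : ℝ) ^ d * (1 / n) ^ K) := by gcongr
      _ = (n : ℝ) ^ (3 * d) * (1 / n) ^ K := by ring
      _ ≤ Real.exp (-(K / 2)) := pow_div_pow_le_exp (by omega) hK6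
      _ ≤ _ := by
        refine Real.exp_le_exp.2 (neg_le_neg ?_)
        have : Δ / (8 * P) * n = x / 2 / 2 := by rw [hx]; field_simp; ring
        rw [this]
        linarith
  refine (sub_le_sub_left hfail 1).trans (hmain.trans (measureReal_mono fun ω hω => ?_))
  rw [Set.mem_ofPred_eq] at hω ⊢
  have hNm1 : 1 ≤ Nm := Nat.choose_pos (by omega)
  exact (threshold_le hρ hd (by omega) ht hNm1 hNm_up).trans hω
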